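/- \textbf{Setting.} Let $F^*$ be a countable set with at least two elements. Let $Q=(Q_{i,j})_{i,j\in F^*}$ be the transition rate matrix of an irreducible, positive recurrent continuous-time Markov chain on $F^*$ ($Q_{i,j}\ge 0$ for $i\ne j$ and $Q_{i,i}=-\sum_{j\neq i}Q_{i,j}$, finite). Let $p_0:F^*\to[0,\infty)$ be bounded and not identically zero, and let $N\ge 2$. Put $$E=\Big\{\eta:F^*\to\mathbb N \ :\ \sum_{i\in F^*}\eta(i)=N\Big\}.$$ For $\eta\in E$ with $\eta(i)\ne 0$, let $T_{i\to j}\eta\in E$ be the configuration obtained from $\eta$ by moving one particle from $i$ to $j$. The $N$-particle Fleming--Viot process is the Markov jump process on $E$ whose generator is, for bounded $f:E\to\mathbb R$, $$\mathcal L f(\eta)=\sum_{i\in F^*}\eta(i)\sum_{j\in F^*}\big(f(T_{i\to j}\eta)-f(\eta)\big)\Big(Q_{i,j}+p_0(i)\frac{\eta(j)}{N-1}\Big).$$ For $\eta,\eta'\in E$ let $d_1(\eta,\eta')=\frac12\sum_{j\in F^*}|\eta(j)-\eta'(j)|$, which is $N$ times the total variation distance between the empirical measures $\frac1N\sum_k\eta(k)\delta_k$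 and $\frac1N\sum_k\eta'(k)\delta_k$. For probability measures $\mu,\mu'$ on $E$ let $\mathcal W_{d_1}(\mu,\mu')$ be the infimum of $\mathbb E[d_1(\eta,\eta')]$ over all couplings $(\eta,\eta')$ of $\mu$ and $\mu'$. Finally let $$\lambda=\inf_{i\neq i'}\Big(Q_{i,i'}+Q_{i',i}+\sum_{j\ne i,i'}\min(Q_{i,j},Q_{i',j})\Big),\qquad \rho=\lambda-\big(\sup p_0-\inf p_0\big).$$ \textbf{Theorem (Wasserstein exponential ergodicity).} For any two $N$-particle Fleming--Viot processes $(\eta_t)_{t\ge0}$ and $(\eta'_t)_{t\ge0}$ with generator $\mathcal L$, with arbitrary initial laws, and for every $t\ge 0$, $$\mathcal W_{d_1}(\mathrm{Law}(\eta_t),\mathrm{Law}(\eta'_t))\le e^{-\rho t}\,\mathcal W_{d_1}(\mathrm{Law}(\eta_0),\mathrm{Law}(\eta'_0)).$$ If moreover $\rho>0$, then the Fleming--Viot process has a unique invariant distribution $\nu_N$, and for every Fleming--Viot process $(\eta_t)_{t\ge 0}$ with generator $\mathcal L$ and every $t\ge0$, $$\mathcal W_{d_1}(\mathrm{Law}(\eta_t),\nu_N)\le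 e^{-\rho t}\,\mathcal W_{d_1}(\mathrm{Law}(\eta_0),\nu_N).$$ -/

import Mathlib

open MeasureTheory Set
open scoped ENNReal NNReal

noncomputable section

namespace FlemingViot

/-! ### Continuous-time Markov chains on a discrete state space -/

section Chains

variable {S : Type*}

/-- A (stable, conservative) transition rate matrix: the off-diagonal entries are non-negative and
each row is summable with sum `0`, so that `-A x x` is the total jump rate out of `x`. -/
structure IsRateMatrix (A : S → S → ℝ) : Prop where
  nonneg : ∀ x y, x ≠ y → 0 ≤ A x y
  row_sum : ∀ x, HasSum (A x) 0

/-- Irreducibility: any state can be reached from any other one through jumps of positive rate. -/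
def IsIrreducible (A : S → S → ℝ) : Prop :=
  ∀ x y, Relation.ReflTransGen (fun a b => a ≠ b ∧ 0 < A a b) x y

open Classical in
/-- First-jump operator: the chain with rates `A` sits at `x` for an exponential time of parameter
`-A x x`, and then jumps to `z ≠ x` with rate `A x z`; `firstJump A x t g` is the expectation of
`g (t - τ) Z` on the event that the first jump time `τ` is at most `t`, where `Z` is the state
reached by the first jump. -/
def firstJump (A : S → S → ℝ) (x : S) (t : ℝ) (g : ℝ → S → ℝ≥0∞) : ℝ≥0∞ :=
  ∫⁻ s in Icc 0 t, ENNReal.ofReal (Real.exp (s * A x x)) *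
    ∑' z, (if z = x then 0 else ENNReal.ofReal (A x z)) * g (t - s) z

open Classical in
/-- Probability that the chain with rates `A` started from `x` is at `y` at time `t`, after at most
`n` jumps. -/
def transProbUpTo (A : S → S → ℝ) (y : S) : ℕ → ℝ → S → ℝ≥0∞
  | 0, t, x => if x = y then ENNReal.ofReal (Real.exp (t * A x x)) else 0
  | n + 1, t, x => (if x = y then ENNReal.ofReal (Real.exp (t * A x x)) else 0) +
      firstJump A x t (transProbUpTo A y n)

/-- Transition probabilities `P_t(x, y)` of the Markov jump process with rates `A` (the minimal
non-negative solution of the backward Kolmogorov equation `∂ₜ P_t = A P_t`, `P_0 = Id`). -/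
def transProb (A : S → S → ℝ) (t : ℝ) (x y : S) : ℝ≥0∞ :=
  ⨆ n, transProbUpTo A y n t x

open Classical in
/-- Probability that the chain with rates `A` started from `z` visits `y` before time `t`, within
its first `n` jumps (being at `y` at time `0` counts as a visit). -/
def hitProbUpTo (A : S → S → ℝ) (y : S) : ℕ → ℝ → S → ℝ≥0∞
  | 0, _, z => if z = y then 1 else 0
  | n + 1, t, z => if z = y then 1 else firstJump A z t (hitProbUpTo A y n)

/-- Probability that the chain with rates `A` started from `y` has left `y` and come back to `y`
before time `t`: the distribution function of the first return time to `y`. -/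
def returnTimeCDF (A : S → S → ℝ) (y : S) (t : ℝ) : ℝ≥0∞ :=
  firstJump A y t (fun s z => ⨆ n, hitProbUpTo A y n s z)

/-- Expectation of the first return time to `y` of the chain started from `y` (the return time
is infinite when the chain does not return). -/
def meanReturnTime (A : S → S → ℝ) (y : S) : ℝ≥0∞ :=
  ∫⁻ t in Ioi (0 : ℝ), (1 - returnTimeCDF A y t)

/-- Positive recurrence: every state is absorbing or has a finite mean return time. -/
def IsPositiveRecurrent (A : S → S → ℝ) : Prop :=
  ∀ y, A y y = 0 ∨ meanReturnTime A y < ∞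

/-- `X` is, under `P`, a continuous-time Markov process whose transition probabilities are those
of the Markov jump process with rates `A`:
`P(X_{s+t} = y | X_u, u ≤ s) = P_t(X_s, y)`. -/
structure IsMarkovJumpProcess [MeasurableSpace S] (A : S → S → ℝ) {Ω : Type*} [MeasurableSpace Ω]
    (P : Measure Ω) (X : ℝ≥0 → Ω → S) : Prop where
  measurable : ∀ t, Measurable (X t)
  markov : ∀ (s t : ℝ≥0) (B : Set Ω),
    MeasurableSet[⨆ u : {u : ℝ≥0 // u ≤ s}, MeasurableSpace.comap (X u.1) inferInstance] B →
    ∀ y : S, P (B ∩ X (s + t) ⁻¹' {y}) = ∫⁻ ω in B, transProb A t (X s ω) y ∂P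

/-- `ν` is an invariant distribution: a probability measure with `ν P_t = ν` for all `t ≥ 0`. -/
structure IsInvariantDistribution [MeasurableSpace S] (A : S → S → ℝ) (ν : Measure S) : Prop where
  isProbabilityMeasure : IsProbabilityMeasure ν
  invariant : ∀ (t : ℝ≥0) (y : S), ∫⁻ x, transProb A t x y ∂ν = ν {y}

end Chains

/-! ### The Fleming-Viot particle system -/

section ParticleSystem

variable {F : Type*} {N : ℕ}

/-- The configurations of `N` particles on `F`: functions `η : F → ℕ` with `∑ i, η i = N` (such
functions have finite support). -/
def Config (F : Type*) (N : ℕ) : Type _ := {η : F →₀ ℕ // η.degree = N}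

/-- `η i` is the number of particles at site `i`. -/
instance : CoeFun (Config F N) (fun _ => F → ℕ) := ⟨fun η => η.1⟩

instance : MeasurableSpace (Config F N) := ⊤

/-- `T_{i → j} η`: one particle is moved from `i` to `j`, if there is one at `i`; otherwise (a case
that has rate zero in the dynamics) nothing changes. -/
def Config.move (i j : F) (η : Config F N) : Config F N :=
  open Classical in
  if h : η i ≠ 0 then
    ⟨η.1 - Finsupp.single i 1 + Finsupp.single j 1, by
      have hle : Finsupp.single i 1 ≤ η.1 := by
        rw [Finsupp.single_le_iff]
        exact Nat.one_le_iff_ne_zero.mpr h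
      have h1 := congrArg Finsupp.degree (tsub_add_cancel_of_le hle)
      rw [map_add, Finsupp.degree_single, η.2] at h1
      rw [map_add, Finsupp.degree_single, h1]⟩
  else η

/-- The generator of the `N`-particle Fleming-Viot process, for the transition rates `Q` and the
death rate `p₀`. -/
def generator (Q : F → F → ℝ) (p₀ : F → ℝ) (N : ℕ) (f : Config F N → ℝ) (η : Config F N) : ℝ :=
  ∑' i, (η i : ℝ) * ∑' j, (f (η.move i j) - f η) * (Q i j + p₀ i * ((η j : ℝ) / ((N : ℝ) - 1)))

/-- The rate matrix of the Fleming-Viot process: `A(η, ζ) = (𝓛 1_{ζ})(η)`. -/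
def rateMatrix (Q : F → F → ℝ) (p₀ : F → ℝ) (N : ℕ) (η ζ : Config F N) : ℝ :=
  generator Q p₀ N (indicator {ζ} 1) η

/-- `d₁(η, η') = ½ ∑ⱼ |η(j) - η'(j)|`. -/
def d₁ (η η' : Config F N) : ℝ :=
  (1 / 2) * ∑' j, |(η j : ℝ) - (η' j : ℝ)|

/-- The Wasserstein distance `𝒲_{d₁}`: the infimum of `𝔼 d₁(η, η')` over all couplings. -/
def wasserstein (μ μ' : Measure (Config F N)) : ℝ≥0∞ :=
  ⨅ (π : Measure (Config F N × Config F N)) (_ : π.map Prod.fst = μ) (_ : π.map Prod.snd = μ'),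
    ∫⁻ x, ENNReal.ofReal (d₁ x.1 x.2) ∂π

open Classical in
/-- The coefficient `λ`. -/
def ergodicCoeff (Q : F → F → ℝ) : ℝ :=
  ⨅ x : {x : F × F // x.1 ≠ x.2}, (Q x.1.1 x.1.2 + Q x.1.2 x.1.1 +
    ∑' j, if j = x.1.1 ∨ j = x.1.2 then 0 else min (Q x.1.1 j) (Q x.1.2 j))

/-- `ρ = λ - (sup p₀ - inf p₀)`. -/
def rho (Q : F → F → ℝ) (p₀ : F → ℝ) : ℝ :=
  ergodicCoeff Q - ((⨆ i, p₀ i) - ⨅ i, p₀ i)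

end ParticleSystem

end FlemingViot

end

/-!
The proof couples two particle systems so that the distance `d₁` decreases on average.

*The coupling.* The particles of two configurations are paired: common particles together, and the
`d = d₁(η, η')` excess particles of `η` with those of `η'`, proportionally (`pairing`). Paired
particles jump to the same site at the largest possible rate, and when they die together they are
reborn at the sites of another pair (`pairRate`, `coupledSystem`). An excess pair meets at rate at
least `λ + inf p₀ (N - d) / (N - 1)` and a common pair separates at rate at most
`sup p₀ d / (N - 1)`, so that the generator of the coupling satisfies `L d₁ ≤ -ρ d₁`
(`jumpSum_transportDist_le`), whence an exponential decay of the mean distance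
(`JumpSystem.semigroup_le_exp`).

*Minimal semigroups.* Transition probabilities are those of the minimal solution of the backward
equation, so all arguments are comparisons with supersolutions (`JumpSystem.semigroup_le`). Jump
systems are described by marks, several of which may lead to the same state or to no move at all.
A projection of a jump system is dominated by the minimal process of its image
(`JumpSystem.semigroup_comp_le`), and coincides with it when no mass is lost by explosion
(`JumpSystem.IsConservative.semigroup_comp`). This identifies the marginals of the coupling.

*Non-explosion.* The rates may be unbounded, and non-explosion comes from the positive recurrence of
`Q`: the only `[0, 1]`-valued solution of `Q h = h` is zero (`eq_zero_of_isPositiveRecurrent`), from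
which one builds a Lyapunov function with finite sublevel sets for the motion of one particle
(`exists_lyapunov`). Its sum over all the particles is a Lyapunov function for the coupling
(`isConservative_coupledSystem`).

*The invariant distribution.* When `ρ > 0`, the oscillation of `P_t g` over the configurations is at
most `N exp (-ρ t)` for all `0 ≤ g ≤ 1`, so `P_t(x, ·)` converges, uniformly in the test function,
to a limit which is a probability measure and the only invariant one
(`JumpSystem.IsConservative.exists_invariant`).
-/

noncomputable section

open Filter Topology

namespace FlemingViot

/-! ### Integrals of exponentials -/

section Integrals

lemma lintegral_mul_exp_neg {c t : ℝ} (hc : 0 ≤ c) (ht : 0 ≤ t) :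
    ∫⁻ s in Icc 0 t, ENNReal.ofReal (c * Real.exp (-(c * s))) =
      ENNReal.ofReal (1 - Real.exp (-(c * t))) := by
  rw [← ofReal_integral_eq_lintegral_ofReal]
  · congr 1
    rw [integral_Icc_eq_integral_Ioc, ← intervalIntegral.integral_of_le ht,
      intervalIntegral.integral_eq_sub_of_hasDerivAt (f := fun s => -Real.exp (-(c * s)))]
    · simp; ring
    · intro x _
      have h : HasDerivAt (fun s => -(c * s)) (-(c * 1)) x := ((hasDerivAt_id x).const_mul c).neg
      exact h.exp.neg.congr_deriv (by ring)
    · exact Continuous.intervalIntegrable (by fun_prop) _ _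
  · exact (Continuous.continuousOn (by fun_prop)).integrableOn_Icc
  · exact Eventually.of_forall fun s => by positivity

lemma lintegral_mul_exp {c a b : ℝ} (hc : 0 ≤ c) (hab : a ≤ b) :
    ∫⁻ s in Icc a b, ENNReal.ofReal (c * Real.exp (c * s)) =
      ENNReal.ofReal (Real.exp (c * b) - Real.exp (c * a)) := by
  rw [← ofReal_integral_eq_lintegral_ofReal]
  · congr 1
    rw [integral_Icc_eq_integral_Ioc, ← intervalIntegral.integral_of_le hab,
      intervalIntegral.integral_eq_sub_of_hasDerivAt (f := fun s => Real.exp (c * s))]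
    · intro x _
      have h : HasDerivAt (fun s => c * s) (c * 1) x := (hasDerivAt_id x).const_mul c
      exact h.exp.congr_deriv (by ring)
    · exact Continuous.intervalIntegrable (by fun_prop) _ _
  · exact (Continuous.continuousOn (by fun_prop)).integrableOn_Icc
  · exact Eventually.of_forall fun s => by positivity

lemma measurable_lintegral_Icc {F : ℝ → ℝ → ℝ≥0∞} (hF : Measurable (Function.uncurry F)) :
    Measurable fun t => ∫⁻ s in Icc 0 t, F t s := by
  have : (fun t => ∫⁻ s in Icc 0 t, F t s) =
      fun t => ∫⁻ s, ({p : ℝ × ℝ | 0 ≤ p.2 ∧ p.2 ≤ p.1}.indicator (Function.uncurry F)) (t, s) := by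
    ext t
    rw [← lintegral_indicator measurableSet_Icc]
    congr 1
  rw [this]
  apply Measurable.lintegral_prod_right'
  apply hF.indicator
  exact (measurableSet_le measurable_const measurable_snd).inter
    (measurableSet_le measurable_snd measurable_fst)

lemma lintegral_Icc_comp_sub (f : ℝ → ℝ≥0∞) (t : ℝ) :
    ∫⁻ s in Icc 0 t, f (t - s) = ∫⁻ s in Icc 0 t, f s := by
  rw [← lintegral_indicator measurableSet_Icc, ← lintegral_indicator measurableSet_Icc,
    ← lintegral_sub_left_eq_self (μ := volume) ((Icc 0 t).indicator f) t]
  congr 1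
  ext s
  simp only [indicator, mem_Icc]
  congr 1
  simp [and_comm]

lemma lintegral_Icc_add {f : ℝ → ℝ≥0∞} {s t : ℝ} (hs : 0 ≤ s) (ht : 0 ≤ t) :
    ∫⁻ v in Icc 0 (s + t), f v =
      (∫⁻ v in Icc 0 s, f v) + ∫⁻ v in Icc 0 t, f (v + s) := by
  have h1 : ∫⁻ v in Icc 0 t, f (v + s) = ∫⁻ v in Icc s (s + t), f v := by
    rw [← lintegral_indicator measurableSet_Icc, ← lintegral_indicator measurableSet_Icc,
      ← lintegral_add_right_eq_self (μ := volume) ((Icc s (s + t)).indicator f) s]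
    congr 1
    ext v
    simp only [indicator, mem_Icc]
    congr 1
    simp [add_comm]
  have h2 : Icc 0 (s + t) = Icc 0 s ∪ Ioc s (s + t) :=
    (Icc_union_Ioc_eq_Icc hs (by linarith)).symm
  have h3 : Disjoint (Icc 0 s) (Ioc s (s + t)) :=
    disjoint_left.2 fun x hx hx' => absurd hx.2 (not_le.2 hx'.1)
  rw [h1, h2, lintegral_union measurableSet_Ioc h3, restrict_Ioc_eq_restrict_Icc]

/-- Fubini on the triangle `0 ≤ w ≤ v ≤ t`. -/
lemma lintegral_Icc_triangle {f g : ℝ → ℝ≥0∞} (hf : Measurable f) (hg : Measurable g) (t : ℝ) :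
    ∫⁻ v in Icc 0 t, f v * ∫⁻ w in Icc 0 v, g w =
      ∫⁻ w in Icc 0 t, g w * ∫⁻ v in Icc w t, f v := by
  have h1 : ∫⁻ v in Icc 0 t, f v * ∫⁻ w in Icc 0 v, g w =
      ∫⁻ v, ∫⁻ w, {p : ℝ × ℝ | 0 ≤ p.2 ∧ p.2 ≤ p.1 ∧ p.1 ≤ t}.indicator
        (fun p => f p.1 * g p.2) (v, w) := by
    rw [← lintegral_indicator measurableSet_Icc]
    congr 1; ext v
    by_cases hv : v ∈ Icc 0 t
    · rw [indicator_of_mem hv, ← lintegral_const_mul _ hg, ← lintegral_indicator measurableSet_Icc]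
      congr 1; ext w
      simp only [indicator, mem_Icc, mem_ofPred_eq, hv.2, and_true]
    · rw [indicator_of_notMem hv, eq_comm, lintegral_eq_zero_iff']
      · refine Eventually.of_forall fun w => ?_
        refine indicator_of_notMem ?_ _
        rintro ⟨h0, h1, h2⟩
        exact hv ⟨h0.trans h1, h2⟩
      · exact (((hf.comp measurable_fst).mul (hg.comp measurable_snd)).indicator
          ((measurableSet_le measurable_const measurable_snd).inter
          ((measurableSet_le measurable_snd measurable_fst).inter
            (measurableSet_le measurable_fst measurable_const)))).comp
              measurable_prodMk_left |>.aemeasurable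
  have h2 : ∫⁻ w in Icc 0 t, g w * ∫⁻ v in Icc w t, f v =
      ∫⁻ w, ∫⁻ v, {p : ℝ × ℝ | 0 ≤ p.2 ∧ p.2 ≤ p.1 ∧ p.1 ≤ t}.indicator
        (fun p => f p.1 * g p.2) (v, w) := by
    rw [← lintegral_indicator measurableSet_Icc]
    congr 1; ext w
    by_cases hw : w ∈ Icc 0 t
    · rw [indicator_of_mem hw, ← lintegral_const_mul _ hf, ← lintegral_indicator measurableSet_Icc]
      congr 1; ext v
      simp only [indicator, mem_Icc, mem_ofPred_eq, hw.1, true_and, mul_comm]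
    · rw [indicator_of_notMem hw, eq_comm, lintegral_eq_zero_iff']
      · refine Eventually.of_forall fun v => ?_
        refine indicator_of_notMem ?_ _
        rintro ⟨h0, h1, h2⟩
        exact hw ⟨h0, h1.trans h2⟩
      · exact (((hf.comp measurable_fst).mul (hg.comp measurable_snd)).indicator
          ((measurableSet_le measurable_const measurable_snd).inter
          ((measurableSet_le measurable_snd measurable_fst).inter
            (measurableSet_le measurable_fst measurable_const)))).comp
              measurable_prodMk_right |>.aemeasurable
  rw [h1, h2, lintegral_lintegral_swap]
  exact (((hf.comp measurable_fst).mul (hg.comp measurable_snd)).indicator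
          ((measurableSet_le measurable_const measurable_snd).inter
          ((measurableSet_le measurable_snd measurable_fst).inter
            (measurableSet_le measurable_fst measurable_const)))).aemeasurable

lemma one_sub_exp_neg_nonneg {a : ℝ} (ha : 0 ≤ a) : 0 ≤ 1 - Real.exp (-a) := by
  simpa using ha

lemma lintegral_exp_mul_exp_sub {κ c t : ℝ} (hc : 0 ≤ κ + c) (ht : 0 ≤ t) (y : ℝ≥0∞) :
    ENNReal.ofReal (Real.exp (-(κ * t))) * y +
      ∫⁻ s in Icc 0 t, ENNReal.ofReal (Real.exp (-(κ * s))) *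
        (ENNReal.ofReal (Real.exp (c * (t - s))) * (ENNReal.ofReal (κ + c) * y)) =
      ENNReal.ofReal (Real.exp (c * t)) * y := by
  have h : ∀ s : ℝ, ENNReal.ofReal (Real.exp (-(κ * s))) *
        (ENNReal.ofReal (Real.exp (c * (t - s))) * (ENNReal.ofReal (κ + c) * y)) =
      ENNReal.ofReal ((κ + c) * Real.exp (-((κ + c) * s))) *
        (ENNReal.ofReal (Real.exp (c * t)) * y) := by
    intro s
    simp only [← mul_assoc]
    congr 1
    rw [← ENNReal.ofReal_mul (by positivity), ← ENNReal.ofReal_mul (by positivity),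
      ← ENNReal.ofReal_mul (by positivity), ← Real.exp_add, mul_comm _ (κ + c),
      mul_assoc (κ + c), ← Real.exp_add]
    ring_nf
  simp_rw [h]
  rw [lintegral_mul_const _ (by fun_prop), lintegral_mul_exp_neg hc ht, ← mul_assoc, ← add_mul,
    ← ENNReal.ofReal_mul (one_sub_exp_neg_nonneg (by positivity)),
    ← ENNReal.ofReal_add (by positivity)
      (mul_nonneg (one_sub_exp_neg_nonneg (by positivity)) (Real.exp_nonneg _))]
  congr 2
  rw [sub_mul, ← Real.exp_add]
  ring_nf

end Integrals

/-- Monotone convergence for sums of extended non-negative reals. -/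
lemma tsum_iSup_of_monotone {ι : Type*} {f : ℕ → ι → ℝ≥0∞} (hf : ∀ i, Monotone fun n => f n i) :
    ∑' i, ⨆ n, f n i = ⨆ n, ∑' i, f n i := by
  let _ : MeasurableSpace ι := ⊤
  simp_rw [← lintegral_count]
  exact lintegral_iSup (fun n => measurable_from_top) fun m n h i => hf i h

lemma eq_zero_of_forall_le_mul {u C : ℝ≥0∞} (hC : C ≠ ∞) (h : ∀ ε : ℝ≥0, 0 < ε → u ≤ ε * C) :
    u = 0 := by
  have h1 : Tendsto (fun n : ℕ => ((((n : ℝ≥0) + 1)⁻¹ : ℝ≥0) : ℝ≥0∞)) atTop (𝓝 0) := by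
    have := tendsto_one_div_add_atTop_nhds_zero_nat (𝕜 := ℝ≥0)
    simp only [one_div] at this
    exact_mod_cast (ENNReal.continuous_coe.tendsto 0).comp this
  have h2 := ENNReal.Tendsto.mul_const (b := C) h1 (Or.inr hC)
  rw [zero_mul] at h2
  exact le_antisymm (ge_of_tendsto' h2 fun n => h _ (by positivity)) bot_le

/-! ### Minimal semigroups of marked jump systems -/

/-- A jump process described through marks: in state `x`, each mark `m` rings at rate `rate x m`,
and the process then moves to `target x m`, which may be `x` itself. Several marks may lead to the
same state. The total rate `total x` is finite. -/
structure JumpSystem (S M : Type*) where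
  rate : S → M → ℝ≥0∞
  target : S → M → S
  total : S → ℝ≥0
  tsum_rate : ∀ x, ∑' m, rate x m = total x

namespace JumpSystem

variable {S M : Type*} (J : JumpSystem S M)

/-- The sum of `φ` over the jumps out of `x`, weighted by their rates. -/
def jumpSum (φ : S → ℝ≥0∞) (x : S) : ℝ≥0∞ := ∑' m, J.rate x m * φ (J.target x m)

/-- The expectation of `u (t - τ) Z` on the event `τ ≤ t`, where `τ` is the first jump time of the
system started from `x` and `Z` the state after that jump. -/
def firstStep (t : ℝ) (u : ℝ → S → ℝ≥0∞) (x : S) : ℝ≥0∞ :=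
  ∫⁻ s in Icc 0 t, ENNReal.ofReal (Real.exp (-(J.total x * s))) * J.jumpSum (u (t - s)) x

/-- The expectation of `g` at time `t` on the event that at most `n` jumps have occurred. -/
def semigroupUpTo (g : S → ℝ≥0∞) : ℕ → ℝ → S → ℝ≥0∞
  | 0, t, x => ENNReal.ofReal (Real.exp (-(J.total x * t))) * g x
  | n + 1, t, x => ENNReal.ofReal (Real.exp (-(J.total x * t))) * g x +
      J.firstStep t (semigroupUpTo g n) x

/-- The minimal semigroup: the expectation of `g` at time `t` on the event that the process has
not exploded. -/
def semigroup (g : S → ℝ≥0∞) (t : ℝ) (x : S) : ℝ≥0∞ := ⨆ n, J.semigroupUpTo g n t x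

lemma jumpSum_mono {φ ψ : S → ℝ≥0∞} (h : ∀ x, φ x ≤ ψ x) (x : S) :
    J.jumpSum φ x ≤ J.jumpSum ψ x :=
  ENNReal.tsum_le_tsum fun _ => mul_le_mul_right (h _) _

lemma jumpSum_add (φ ψ : S → ℝ≥0∞) (x : S) :
    J.jumpSum (fun z => φ z + ψ z) x = J.jumpSum φ x + J.jumpSum ψ x := by
  simp_rw [jumpSum, mul_add, ENNReal.tsum_add]

lemma jumpSum_const_mul (c : ℝ≥0∞) (φ : S → ℝ≥0∞) (x : S) :
    J.jumpSum (fun z => c * φ z) x = c * J.jumpSum φ x := by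
  simp_rw [jumpSum, ← ENNReal.tsum_mul_left, mul_left_comm]

lemma jumpSum_mul_const (c : ℝ≥0∞) (φ : S → ℝ≥0∞) (x : S) :
    J.jumpSum (fun z => φ z * c) x = J.jumpSum φ x * c := by
  simp_rw [mul_comm _ c, jumpSum_const_mul]

@[simp] lemma jumpSum_const (c : ℝ≥0∞) (x : S) :
    J.jumpSum (fun _ => c) x = J.total x * c := by
  simp_rw [jumpSum, ENNReal.tsum_mul_right, J.tsum_rate]

lemma jumpSum_iSup {f : ℕ → S → ℝ≥0∞} (hf : ∀ x, Monotone fun n => f n x) (x : S) :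
    J.jumpSum (fun z => ⨆ n, f n z) x = ⨆ n, J.jumpSum (f n) x := by
  simp_rw [jumpSum, ENNReal.mul_iSup]
  exact tsum_iSup_of_monotone fun m a b h => mul_le_mul_right (hf _ h) _

lemma jumpSum_tsum {ι : Type*} (f : ι → S → ℝ≥0∞) (x : S) :
    J.jumpSum (fun z => ∑' i, f i z) x = ∑' i, J.jumpSum (f i) x := by
  simp_rw [jumpSum, ← ENNReal.tsum_mul_left]
  rw [ENNReal.tsum_comm]

lemma firstStep_mono {t : ℝ} {u v : ℝ → S → ℝ≥0∞} (h : ∀ s ∈ Icc 0 t, ∀ x, u s x ≤ v s x) (x : S) :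
    J.firstStep t u x ≤ J.firstStep t v x := by
  refine setLIntegral_mono' measurableSet_Icc fun s hs => ?_
  gcongr
  exact J.jumpSum_mono (h _ ⟨by linarith [hs.2], by linarith [hs.1]⟩) x

lemma measurable_exp_total (x : S) :
    Measurable fun s : ℝ => ENNReal.ofReal (Real.exp (-(J.total x * s))) := by fun_prop

lemma firstStep_const {t : ℝ} (ht : 0 ≤ t) (c : ℝ≥0∞) (x : S) :
    J.firstStep t (fun _ _ => c) x = ENNReal.ofReal (1 - Real.exp (-(J.total x * t))) * c := by
  simp only [firstStep, jumpSum_const, ← mul_assoc]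
  rw [lintegral_mul_const _ (by fun_prop), ← lintegral_mul_exp_neg (J.total x).coe_nonneg ht]
  congr 2; ext s
  rw [ENNReal.ofReal_mul (by positivity), mul_comm, ENNReal.ofReal_coe_nnreal]

lemma monotone_semigroupUpTo (g : S → ℝ≥0∞) (t : ℝ) (x : S) :
    Monotone fun n => J.semigroupUpTo g n t x := by
  refine monotone_nat_of_le_succ fun n => ?_
  induction n generalizing t x with
  | zero => exact le_self_add
  | succ n ih =>
    simp only [semigroupUpTo] at ih ⊢
    gcongr
    exact J.firstStep_mono (fun s _ z => ih s z) x

/-- Minimality: the semigroup is below every supersolution of the backward equation. -/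
lemma semigroup_le {g : S → ℝ≥0∞} {u : ℝ → S → ℝ≥0∞}
    (hu : ∀ t, 0 ≤ t → ∀ x, ENNReal.ofReal (Real.exp (-(J.total x * t))) * g x +
      J.firstStep t u x ≤ u t x) {t : ℝ} (ht : 0 ≤ t) (x : S) :
    J.semigroup g t x ≤ u t x := by
  refine iSup_le fun n => ?_
  induction n generalizing t x with
  | zero => exact le_self_add.trans (hu t ht x)
  | succ n ih =>
    refine le_trans ?_ (hu t ht x)
    simp only [semigroupUpTo]
    gcongr
    exact J.firstStep_mono (fun s hs z => ih hs.1 z) x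

/-- A Lyapunov function `f` whose generator is at most `(b - a) f` grows at most like
`exp ((b - a) t)` along the minimal semigroup. The rates `a` and `b` are kept apart so that the
hypothesis can be stated without subtraction. -/
lemma semigroup_le_exp {f : S → ℝ≥0∞} (hf : ∀ x, f x ≠ ∞) (a b : ℝ≥0)
    (h : ∀ x, J.jumpSum f x + a * f x ≤ (J.total x + b) * f x) {t : ℝ} (ht : 0 ≤ t) (x : S) :
    J.semigroup f t x ≤ ENNReal.ofReal (Real.exp (((b : ℝ) - a) * t)) * f x := by
  refine J.semigroup_le (u := fun t x => ENNReal.ofReal (Real.exp (((b : ℝ) - a) * t)) * f x)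
    (fun t ht x => ?_) ht x
  simp only [firstStep, jumpSum_const_mul]
  rcases eq_or_ne (f x) 0 with h0 | h0
  · have : J.jumpSum f x = 0 := by
      have := h x
      rw [h0, mul_zero, mul_zero, add_zero] at this
      exact le_antisymm this bot_le
    simp [h0, this]
  have hab : (a : ℝ) ≤ J.total x + b := by
    have h1 : (a : ℝ≥0∞) * f x ≤ (J.total x + b) * f x := le_add_self.trans (h x)
    rw [ENNReal.mul_le_mul_iff_left h0 (hf x)] at h1
    exact_mod_cast h1
  have hJ : J.jumpSum f x ≤ ENNReal.ofReal (J.total x + b - a) * f x := by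
    have h1 : ENNReal.ofReal (J.total x + b - a) * f x + a * f x = (J.total x + b) * f x := by
      rw [← add_mul, ← ENNReal.ofReal_coe_nnreal (p := a), ← ENNReal.ofReal_add (by linarith)
        a.coe_nonneg, sub_add_cancel, ENNReal.ofReal_add (by positivity) (by positivity)]
      simp
    exact (ENNReal.add_le_add_iff_right (ENNReal.mul_ne_top (by simp) (hf x))).1
      ((h x).trans h1.ge)
  set c : ℝ := (b : ℝ) - a
  have hc : 0 ≤ (J.total x : ℝ) + c := by simp only [c]; linarith
  rw [← lintegral_exp_mul_exp_sub hc ht (f x)]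
  refine add_le_add_right (lintegral_mono fun s => ?_) _
  dsimp only
  gcongr
  rwa [show (J.total x : ℝ) + b - a = J.total x + c by simp only [c]; ring] at hJ

lemma semigroup_one_le {t : ℝ} (ht : 0 ≤ t) (x : S) : J.semigroup 1 t x ≤ 1 := by
  have := J.semigroup_le_exp (f := 1) (by simp) 0 0 (fun x => by
    have := J.jumpSum_const 1 x
    simp only [Pi.one_def] at *
    simp [this]) ht x
  simpa using this

/-- The transition probabilities of the minimal semigroup. -/
def kernel (t : ℝ) (x y : S) : ℝ≥0∞ := J.semigroup (indicator {y} 1) t x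

variable [Countable M]

lemma measurable_jumpSum {u : ℝ → S → ℝ≥0∞} (hu : ∀ x, Measurable fun t => u t x) (x : S) :
    Measurable fun t => J.jumpSum (u t) x :=
  Measurable.tsum fun _ => (hu _).const_mul _

lemma measurable_firstStep {u : ℝ → S → ℝ≥0∞} (hu : ∀ x, Measurable fun t => u t x) (x : S) :
    Measurable fun t => J.firstStep t u x := by
  apply measurable_lintegral_Icc (F := fun t s => _ * J.jumpSum (u (t - s)) x)
  exact ((J.measurable_exp_total x).comp measurable_snd).mul
    ((J.measurable_jumpSum hu x).comp (measurable_fst.sub measurable_snd))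

lemma firstStep_add {u v : ℝ → S → ℝ≥0∞} (hu : ∀ x, Measurable fun t => u t x) (t : ℝ) (x : S) :
    J.firstStep t (fun s z => u s z + v s z) x = J.firstStep t u x + J.firstStep t v x := by
  simp_rw [firstStep, jumpSum_add, mul_add]
  exact lintegral_add_left ((J.measurable_exp_total x).mul
    ((J.measurable_jumpSum hu x).comp (by fun_prop))) _

lemma firstStep_iSup {u : ℕ → ℝ → S → ℝ≥0∞} (hu : ∀ n x, Measurable fun t => u n t x)
    (hm : ∀ t x, Monotone fun n => u n t x) (t : ℝ) (x : S) :
    J.firstStep t (fun s z => ⨆ n, u n s z) x = ⨆ n, J.firstStep t (u n) x := by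
  simp_rw [firstStep, J.jumpSum_iSup (hm _), ENNReal.mul_iSup]
  refine lintegral_iSup (fun n => (J.measurable_exp_total x).mul
    ((J.measurable_jumpSum (hu n) x).comp (by fun_prop))) fun a b h s => ?_
  dsimp only
  gcongr
  exact J.jumpSum_mono (fun z => hm _ z h) x

lemma firstStep_tsum {ι : Type*} [Countable ι] {u : ι → ℝ → S → ℝ≥0∞}
    (hu : ∀ n x, Measurable fun t => u n t x) (t : ℝ) (x : S) :
    J.firstStep t (fun s z => ∑' i, u i s z) x = ∑' i, J.firstStep t (u i) x := by
  simp_rw [firstStep, J.jumpSum_tsum, ← ENNReal.tsum_mul_left]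
  exact lintegral_tsum fun n => ((J.measurable_exp_total x).mul
    ((J.measurable_jumpSum (hu n) x).comp (by fun_prop))).aemeasurable

lemma firstStep_mul_const {u : ℝ → S → ℝ≥0∞} (hu : ∀ x, Measurable fun t => u t x) (c : ℝ≥0∞)
    (t : ℝ) (x : S) :
    J.firstStep t (fun s z => u s z * c) x = J.firstStep t u x * c := by
  simp_rw [firstStep, J.jumpSum_mul_const, ← mul_assoc]
  exact lintegral_mul_const _ ((J.measurable_exp_total x).mul
    ((J.measurable_jumpSum hu x).comp (by fun_prop)))

lemma measurable_semigroupUpTo (g : S → ℝ≥0∞) (n : ℕ) (x : S) :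
    Measurable fun t => J.semigroupUpTo g n t x := by
  induction n generalizing x with
  | zero => exact (J.measurable_exp_total x).mul_const _
  | succ n ih => exact ((J.measurable_exp_total x).mul_const _).add (J.measurable_firstStep ih x)

lemma measurable_semigroup (g : S → ℝ≥0∞) (x : S) : Measurable fun t => J.semigroup g t x :=
  Measurable.iSup fun n => J.measurable_semigroupUpTo g n x

/-- The backward Kolmogorov equation, in integral form. -/
lemma semigroup_eq (g : S → ℝ≥0∞) (t : ℝ) (x : S) :
    J.semigroup g t x = ENNReal.ofReal (Real.exp (-(J.total x * t))) * g x +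
      J.firstStep t (J.semigroup g) x := by
  have h := J.firstStep_iSup (J.measurable_semigroupUpTo g) (J.monotone_semigroupUpTo g) t x
  rw [show J.semigroup g = fun s z => ⨆ n, J.semigroupUpTo g n s z from rfl, h, ENNReal.add_iSup]
  exact ((J.monotone_semigroupUpTo g t x).iSup_nat_add 1).symm

lemma semigroupUpTo_eq_tsum [Countable S] (g : S → ℝ≥0∞) (n : ℕ) (t : ℝ) (x : S) :
    J.semigroupUpTo g n t x = ∑' y, J.semigroupUpTo (indicator {y} 1) n t x * g y := by
  classical
  have h0 : ∀ x, g x = ∑' y, indicator {y} (1 : S → ℝ≥0∞) x * g y := fun x => by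
    rw [tsum_eq_single x fun y hy => by simp [indicator, hy.symm]]
    simp
  induction n generalizing t x with
  | zero =>
    simp only [semigroupUpTo, mul_assoc, ENNReal.tsum_mul_left]
    rw [← h0]
  | succ n ih =>
    simp only [semigroupUpTo, add_mul, ENNReal.tsum_add, mul_assoc, ENNReal.tsum_mul_left]
    rw [← h0]
    congr 1
    simp_rw [← J.firstStep_mul_const (J.measurable_semigroupUpTo _ _)]
    rw [← J.firstStep_tsum fun y x => (J.measurable_semigroupUpTo _ _ x).mul_const _]
    congr 1
    ext s z
    exact ih s z

lemma semigroup_eq_tsum [Countable S] (g : S → ℝ≥0∞) (t : ℝ) (x : S) :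
    J.semigroup g t x = ∑' y, J.kernel t x y * g y := by
  simp_rw [kernel, semigroup, ENNReal.iSup_mul]
  rw [tsum_iSup_of_monotone]
  · simp_rw [← semigroupUpTo_eq_tsum]
  · intro y a b h
    dsimp only
    gcongr
    exact J.monotone_semigroupUpTo _ t x h

/-- A process is non-explosive as soon as it has a Lyapunov function that grows at most
exponentially and has finite sublevel sets. The explosion probability `u` satisfies
`u ≤ firstStep u`, which contracts it towards any small multiple of the Lyapunov function. -/
lemma semigroup_one_eq {W : S → ℝ≥0∞} (hW : ∀ x, W x ≠ ∞) (hfin : ∀ r : ℝ≥0, {x | W x ≤ r}.Finite)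
    (b : ℝ≥0) (h : ∀ x, J.jumpSum W x ≤ (J.total x + b) * W x) {t : ℝ} (ht : 0 ≤ t) (x : S) :
    J.semigroup 1 t x = 1 := by
  set u : ℝ → S → ℝ≥0∞ := fun s z => 1 - J.semigroup 1 s z with hu
  have hu1 : ∀ s z, u s z ≤ 1 := fun s z => tsub_le_self
  -- explosion before time `s` can only happen after the first jump
  have hu_le : ∀ s, 0 ≤ s → ∀ z, u s z ≤ J.firstStep s u z := by
    intro s hs z
    have h1 : (1 : ℝ≥0∞) = ENNReal.ofReal (Real.exp (-(J.total z * s))) + J.firstStep s 1 z := by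
      have := J.firstStep_const hs 1 z
      rw [show (1 : ℝ → S → ℝ≥0∞) = fun _ _ => 1 from rfl, this, mul_one,
        ← ENNReal.ofReal_add (by positivity)]
      · simp
      · exact one_sub_exp_neg_nonneg (by positivity)
    have h2 : J.firstStep s 1 z = J.firstStep s (J.semigroup 1) z + J.firstStep s u z := by
      rw [← J.firstStep_add (J.measurable_semigroup 1)]
      refine le_antisymm (J.firstStep_mono (fun r _ y => ?_) z)
        (J.firstStep_mono (fun r hr y => ?_) z)
      · exact le_add_tsub
      · exact (add_tsub_cancel_of_le (J.semigroup_one_le hr.1 y)).le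
    rw [hu, tsub_le_iff_left, J.semigroup_eq, Pi.one_apply, mul_one, add_assoc, ← h2, ← h1]
  -- `exp (b t) W` is a supersolution of the same equation
  have hWt : ∀ s, 0 ≤ s → ∀ z, J.firstStep s
      (fun r y => ENNReal.ofReal (Real.exp (b * r)) * W y) z ≤
        ENNReal.ofReal (Real.exp (b * s)) * W z := by
    intro s hs z
    rw [← lintegral_exp_mul_exp_sub (κ := J.total z) (by positivity) hs (W z)]
    refine le_add_left (lintegral_mono fun r => ?_)
    simp only [jumpSum_const_mul]
    gcongr
    refine (h z).trans (le_of_eq ?_)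
    rw [ENNReal.ofReal_add (by positivity) (by positivity)]
    simp
  have key : ∀ ε : ℝ≥0, 0 < ε → ∀ z, ∀ s ∈ Icc 0 t,
      u s z ≤ ε * (ENNReal.ofReal (Real.exp (b * s)) * W z) := by
    intro ε hε
    -- the exit rates are bounded by some `q` where `ε W ≤ 1`;
    -- there is nothing to prove elsewhere
    have hK := hfin ε⁻¹
    obtain ⟨q, hq⟩ : ∃ q : ℝ≥0, ∀ z, W z ≤ (ε⁻¹ : ℝ≥0) → J.total z ≤ q := by
      obtain ⟨q, hq⟩ := (hK.image J.total).bddAbove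
      exact ⟨q, fun z hz => hq ⟨z, hz, rfl⟩⟩
    set r : ℝ≥0∞ := ENNReal.ofReal (1 - Real.exp (-(q * t))) with hr
    have hr1 : r < 1 := by
      rw [hr, ENNReal.ofReal_lt_one]
      linarith [Real.exp_pos (-(q * t))]
    -- the chain jumps before time `t` with probability at most `r < 1`, which gains a factor `r`
    have step : ∀ n : ℕ, ∀ z, ∀ s ∈ Icc 0 t,
        u s z ≤ ε * (ENNReal.ofReal (Real.exp (b * s)) * W z) + r ^ n := by
      intro n
      induction n with
      | zero => exact fun z s _ => (hu1 s z).trans (by simp)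
      | succ n ih =>
        intro z s hs
        by_cases hz : W z ≤ (ε⁻¹ : ℝ≥0)
        · calc u s z ≤ J.firstStep s u z := hu_le s hs.1 z
            _ ≤ J.firstStep s (fun s z => ε * (ENNReal.ofReal (Real.exp (b * s)) * W z) + r ^ n) z :=
                J.firstStep_mono (fun v hv y => ih y v ⟨hv.1, hv.2.trans hs.2⟩) z
            _ = J.firstStep s (fun s z => (ENNReal.ofReal (Real.exp (b * s)) * W z) * ε) z +
                  J.firstStep s (fun _ _ => r ^ n) z := by
                simp_rw [mul_comm (ε : ℝ≥0∞)]
                rw [J.firstStep_add fun y => by fun_prop]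
            _ ≤ ε * (ENNReal.ofReal (Real.exp (b * s)) * W z) + r ^ (n + 1) := by
                rw [J.firstStep_mul_const (fun y => by fun_prop), J.firstStep_const hs.1,
                  mul_comm (ε : ℝ≥0∞), pow_succ']
                gcongr
                · exact hWt s hs.1 z
                · rw [hr]
                  apply ENNReal.ofReal_le_ofReal
                  have : (J.total z : ℝ) * s ≤ q * t :=
                    mul_le_mul (by exact_mod_cast hq z hz) hs.2 hs.1 q.coe_nonneg
                  gcongr
        · refine (hu1 s z).trans (le_add_right ?_)
          have h1 : (1 : ℝ≥0∞) ≤ ENNReal.ofReal (Real.exp (b * s)) := by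
            rw [ENNReal.one_le_ofReal]
            exact Real.one_le_exp (mul_nonneg b.coe_nonneg hs.1)
          calc (1 : ℝ≥0∞) = ε * (1 * (ε⁻¹ : ℝ≥0)) := by
                rw [one_mul]; exact_mod_cast (mul_inv_cancel₀ hε.ne').symm
            _ ≤ _ := by gcongr; exact (not_le.1 hz).le
    intro z s hs
    refine ge_of_tendsto' (x := atTop) ?_ fun n => step n z s hs
    have := (ENNReal.tendsto_pow_atTop_nhds_zero_of_lt_one hr1).const_add
      (ε * (ENNReal.ofReal (Real.exp (b * s)) * W z))
    simpa using this
  have hzero : u t x = 0 :=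
    eq_zero_of_forall_le_mul (ENNReal.mul_ne_top ENNReal.ofReal_ne_top (hW x))
      fun ε hε => key ε hε x t ⟨ht, le_rfl⟩
  refine le_antisymm (J.semigroup_one_le ht x) ?_
  rwa [hu, tsub_eq_zero_iff_le] at hzero

end JumpSystem

/-! ### Restarts and idle jumps in the backward equation -/

/-- Jumps that do not move the process can be added at any rate `c` without changing the solution
of the backward equation. -/
lemma backward_eq_of_added_rate {q c : ℝ} (hc : 0 ≤ c) {a : ℝ≥0∞} {h u : ℝ → ℝ≥0∞}
    (hh : Measurable h)
    (hu : ∀ t, 0 ≤ t → u t = ENNReal.ofReal (Real.exp (-(q * t))) *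
      (a + ∫⁻ v in Icc 0 t, ENNReal.ofReal (Real.exp (q * v)) * h v)) {t : ℝ} (ht : 0 ≤ t) :
    ENNReal.ofReal (Real.exp (-((q + c) * t))) * (a + ∫⁻ v in Icc 0 t,
      ENNReal.ofReal (Real.exp ((q + c) * v)) * (h v + ENNReal.ofReal c * u v)) = u t := by
  set H : ℝ → ℝ≥0∞ := fun v => ENNReal.ofReal (Real.exp (q * v)) * h v with hH
  have hHm : Measurable H := by fun_prop
  set E : ℝ → ℝ≥0∞ := fun v => ENNReal.ofReal (c * Real.exp (c * v)) with hE
  have hEm : Measurable E := by fun_prop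
  have h1 : ∫⁻ v in Icc 0 t, ENNReal.ofReal (Real.exp ((q + c) * v)) *
      (h v + ENNReal.ofReal c * u v) = ∫⁻ v in Icc 0 t,
        (ENNReal.ofReal (Real.exp (c * v)) * H v + (E v * a + E v * ∫⁻ w in Icc 0 v, H w)) := by
    refine setLIntegral_congr_fun measurableSet_Icc fun v hv => ?_
    rw [hu v hv.1, mul_add, ← mul_add (E v)]
    simp only [hH, hE]
    congr 1
    · rw [← mul_assoc, ← ENNReal.ofReal_mul (by positivity), ← Real.exp_add]
      ring_nf
    · simp only [← mul_assoc]
      congr 1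
      rw [← ENNReal.ofReal_mul (by positivity), ← ENNReal.ofReal_mul (by positivity),
        mul_comm _ c, mul_assoc, ← Real.exp_add]
      ring_nf
  have h2 : ∀ w ∈ Icc 0 t, ENNReal.ofReal (Real.exp (c * w)) * H w + H w * ∫⁻ v in Icc w t, E v =
      ENNReal.ofReal (Real.exp (c * t)) * H w := by
    intro w hw
    rw [lintegral_mul_exp hc hw.2, mul_comm (H w), ← add_mul, ← ENNReal.ofReal_add (by positivity)]
    · congr 2; ring
    · have : c * w ≤ c * t := mul_le_mul_of_nonneg_left hw.2 hc
      simpa using this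
  have h3 : (∫⁻ w in Icc 0 t, ENNReal.ofReal (Real.exp (c * w)) * H w) +
      ∫⁻ w in Icc 0 t, H w * ∫⁻ v in Icc w t, E v =
        ENNReal.ofReal (Real.exp (c * t)) * ∫⁻ w in Icc 0 t, H w := by
    rw [← lintegral_add_left (by fun_prop), ← lintegral_const_mul _ hHm]
    exact setLIntegral_congr_fun measurableSet_Icc h2
  have h4 : a + (∫⁻ v in Icc 0 t, E v) * a = ENNReal.ofReal (Real.exp (c * t)) * a := by
    rw [lintegral_mul_exp hc ht, mul_zero, Real.exp_zero]
    nth_rewrite 1 [← one_mul a]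
    rw [← ENNReal.ofReal_one, ← add_mul, ← ENNReal.ofReal_add zero_le_one]
    · congr 2; ring
    · simpa using mul_nonneg hc ht
  rw [h1, lintegral_add_left (by fun_prop), lintegral_add_left (by fun_prop),
    lintegral_mul_const _ hEm, lintegral_Icc_triangle hEm hHm, hu t ht]
  -- group the boundary terms together, and the two integrals together
  have h5 : ∀ x y z : ℝ≥0∞, a + (x + (y + z)) = (a + y) + (x + z) := fun x y z => by
    abel
  rw [h5, h3, h4, ← mul_add, ← mul_assoc, ← ENNReal.ofReal_mul (by positivity), ← Real.exp_add]
  ring_nf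

/-- Two upper bounds that add up to an equality are equalities; applied to `g` and `1 - g`. -/
lemma eq_of_le_of_add_le {a a' b b' : ℝ≥0∞} (h : a ≤ b) (h' : a' ≤ b')
    (hs : b + b' ≤ a + a') (ha' : a' ≠ ∞) : a = b := by
  refine le_antisymm h ?_
  have : b + a' ≤ a + a' := (add_le_add_right h' b).trans hs
  exact (ENNReal.add_le_add_iff_right ha').1 this

namespace JumpSystem

variable {S M : Type*} (J : JumpSystem S M)

lemma firstStep_eq (t : ℝ) {u : ℝ → S → ℝ≥0∞} (x : S)
    (hu : Measurable fun t => J.jumpSum (u t) x) :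
    J.firstStep t u x = ENNReal.ofReal (Real.exp (-(J.total x * t))) *
      ∫⁻ v in Icc 0 t, ENNReal.ofReal (Real.exp (J.total x * v)) * J.jumpSum (u v) x := by
  rw [← lintegral_const_mul _ (by fun_prop), ← lintegral_Icc_comp_sub]
  refine lintegral_congr fun s => ?_
  rw [← mul_assoc, ← ENNReal.ofReal_mul (by positivity), ← Real.exp_add]
  ring_nf

variable [Countable M]

lemma semigroup_eq' (g : S → ℝ≥0∞) (t : ℝ) (x : S) :
    J.semigroup g t x = ENNReal.ofReal (Real.exp (-(J.total x * t))) *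
      (g x + ∫⁻ v in Icc 0 t, ENNReal.ofReal (Real.exp (J.total x * v)) *
        J.jumpSum (J.semigroup g v) x) := by
  rw [J.semigroup_eq, J.firstStep_eq t x (J.measurable_jumpSum (J.measurable_semigroup g) x),
    mul_add]

/-- The backward equation restarted at time `s`. -/
lemma semigroup_restart (g : S → ℝ≥0∞) {s t : ℝ} (hs : 0 ≤ s) (ht : 0 ≤ t) (x : S) :
    J.semigroup g (s + t) x = ENNReal.ofReal (Real.exp (-(J.total x * t))) * J.semigroup g s x +
      J.firstStep t (fun r => J.semigroup g (r + s)) x := by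
  have hm := J.measurable_jumpSum (J.measurable_semigroup g) x
  rw [J.firstStep_eq t x (u := fun r => J.semigroup g (r + s)) (hm.comp (measurable_add_const s)),
    J.semigroup_eq' g (s + t), J.semigroup_eq' g s, lintegral_Icc_add hs ht, ← mul_add,
    ← add_assoc, mul_add]
  have h1 : ∀ v, ENNReal.ofReal (Real.exp (J.total x * (v + s))) =
      ENNReal.ofReal (Real.exp (J.total x * s)) * ENNReal.ofReal (Real.exp (J.total x * v)) := by
    intro v
    rw [← ENNReal.ofReal_mul (by positivity), ← Real.exp_add]
    ring_nf
  simp_rw [h1, mul_assoc]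
  have hm' : Measurable fun v => J.jumpSum (J.semigroup g (v + s)) x :=
    hm.comp (measurable_add_const s)
  have h2 : ENNReal.ofReal (Real.exp (-(J.total x * (s + t)))) =
      ENNReal.ofReal (Real.exp (-(J.total x * t))) *
        ENNReal.ofReal (Real.exp (-(J.total x * s))) := by
    rw [← ENNReal.ofReal_mul (by positivity), ← Real.exp_add]
    ring_nf
  have h3 : ENNReal.ofReal (Real.exp (-(J.total x * (s + t)))) *
      ENNReal.ofReal (Real.exp (J.total x * s)) =
        ENNReal.ofReal (Real.exp (-(J.total x * t))) := by
    rw [← ENNReal.ofReal_mul (by positivity), ← Real.exp_add]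
    ring_nf
  rw [lintegral_const_mul _ (by fun_prop), mul_add (ENNReal.ofReal (Real.exp (-(J.total x * t)))),
    ← mul_assoc, ← mul_assoc, h3, h2]

/-- One half of the Chapman-Kolmogorov equation, by minimality; the other half follows for
conservative systems. -/
lemma semigroup_semigroup_le (g : S → ℝ≥0∞) {s t : ℝ} (hs : 0 ≤ s) (ht : 0 ≤ t) (x : S) :
    J.semigroup (J.semigroup g s) t x ≤ J.semigroup g (s + t) x :=
  J.semigroup_le (u := fun t => J.semigroup g (s + t)) (fun t ht x => by
    simpa only [add_comm _ s] using (J.semigroup_restart g hs ht x).ge) ht x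

/-- If `π` maps the jumps of `J'` to the jumps of `J`, up to jumps that `π` does not see, then the
image under `π` of the minimal process of `J'` is dominated by the minimal process of `J`. -/
lemma semigroup_comp_le {S' M' : Type*} (J' : JumpSystem S' M') (π : S' → S)
    (h : ∀ x, ∃ s : ℝ≥0, J'.total x = J.total (π x) + s ∧ ∀ φ : S → ℝ≥0∞,
      J'.jumpSum (fun z => φ (π z)) x = J.jumpSum φ (π x) + s * φ (π x))
    (g : S → ℝ≥0∞) {t : ℝ} (ht : 0 ≤ t) (x : S') :
    J'.semigroup (fun z => g (π z)) t x ≤ J.semigroup g t (π x) := by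
  refine J'.semigroup_le (u := fun t x => J.semigroup g t (π x)) (fun t ht x => ?_) ht x
  obtain ⟨s, hs, hφ⟩ := h x
  have hm := J.measurable_jumpSum (J.measurable_semigroup g) (π x)
  have hm' := J.measurable_semigroup g (π x)
  rw [J'.firstStep_eq t x (by simp_rw [hφ]; fun_prop), ← mul_add]
  simp_rw [hφ]
  refine le_of_eq ?_
  have := backward_eq_of_added_rate (q := J.total (π x)) (c := s) s.coe_nonneg (a := g (π x)) hm
    (fun t _ => J.semigroup_eq' g t (π x)) ht
  rw [ENNReal.ofReal_coe_nnreal] at this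
  rw [← this, hs, NNReal.coe_add]

/-- The process does not explode: its transition probabilities sum to one. -/
def IsConservative : Prop := ∀ t, 0 ≤ t → ∀ x, J.semigroup 1 t x = 1

variable [Countable S]

lemma semigroup_add (g h : S → ℝ≥0∞) (t : ℝ) (x : S) :
    J.semigroup (fun z => g z + h z) t x = J.semigroup g t x + J.semigroup h t x := by
  rw [J.semigroup_eq_tsum, J.semigroup_eq_tsum g, J.semigroup_eq_tsum h, ← ENNReal.tsum_add]
  simp_rw [mul_add]

lemma semigroup_mono {g h : S → ℝ≥0∞} (hgh : ∀ x, g x ≤ h x) (t : ℝ) (x : S) :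
    J.semigroup g t x ≤ J.semigroup h t x := by
  rw [J.semigroup_eq_tsum, J.semigroup_eq_tsum h]
  exact ENNReal.tsum_le_tsum fun y => mul_le_mul_right (hgh y) _

lemma semigroup_const_mul (c : ℝ≥0∞) (g : S → ℝ≥0∞) (t : ℝ) (x : S) :
    J.semigroup (fun z => c * g z) t x = c * J.semigroup g t x := by
  rw [J.semigroup_eq_tsum, J.semigroup_eq_tsum g, ← ENNReal.tsum_mul_left]
  simp_rw [mul_left_comm]

variable {J}

/-- The Chapman-Kolmogorov equation. -/
lemma IsConservative.semigroup_semigroup (hJ : J.IsConservative) {g : S → ℝ≥0∞}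
    (hg : ∀ x, g x ≤ 1) {s t : ℝ} (hs : 0 ≤ s) (ht : 0 ≤ t) (x : S) :
    J.semigroup (J.semigroup g s) t x = J.semigroup g (s + t) x := by
  have h1 : (fun z => g z + (1 - g z)) = 1 := by ext z; simp [hg z]
  have hsum : ∀ t x, J.semigroup g t x + J.semigroup (fun z => 1 - g z) t x =
      J.semigroup 1 t x := fun t x => by rw [← J.semigroup_add, h1]
  have hs1 : (fun z => J.semigroup g s z + J.semigroup (fun z => 1 - g z) s z) = 1 := by
    ext z; rw [hsum, hJ s hs]; rfl
  refine eq_of_le_of_add_le (J.semigroup_semigroup_le g hs ht x)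
    (J.semigroup_semigroup_le (fun z => 1 - g z) hs ht x) ?_ ?_
  · rw [hsum, hJ _ (add_nonneg hs ht), ← J.semigroup_add, hs1, hJ t ht]
  · refine ne_top_of_le_ne_top ENNReal.one_ne_top
      ((J.semigroup_mono (h := 1) (fun z => ?_) t x).trans_eq (hJ t ht x))
    rw [← hs1]
    exact le_add_self

/-- The image under `π` of a conservative process that projects to `J` is the process of `J`. -/
lemma IsConservative.semigroup_comp {S' M' : Type*} [Countable S'] [Countable M']
    {J' : JumpSystem S' M'} (hJ' : J'.IsConservative) (π : S' → S)
    (h : ∀ x, ∃ s : ℝ≥0, J'.total x = J.total (π x) + s ∧ ∀ φ : S → ℝ≥0∞,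
      J'.jumpSum (fun z => φ (π z)) x = J.jumpSum φ (π x) + s * φ (π x))
    {g : S → ℝ≥0∞} (hg : ∀ x, g x ≤ 1) {t : ℝ} (ht : 0 ≤ t) (x : S') :
    J'.semigroup (fun z => g (π z)) t x = J.semigroup g t (π x) := by
  have h1 : (fun z => g z + (1 - g z)) = 1 := by ext z; simp [hg z]
  have h1' : (fun z => g (π z) + (1 - g (π z))) = 1 := by ext z; simp [hg (π z)]
  refine eq_of_le_of_add_le (J.semigroup_comp_le J' π h g ht x)
    (J.semigroup_comp_le J' π h (fun z => 1 - g z) ht x) ?_ ?_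
  · rw [← J.semigroup_add, h1, ← J'.semigroup_add, h1', hJ' t ht]
    exact J.semigroup_one_le ht _
  · refine ne_top_of_le_ne_top ENNReal.one_ne_top
      ((J'.semigroup_mono (h := 1) (fun z => ?_) t x).trans_eq (hJ' t ht x))
    exact tsub_le_self

end JumpSystem

/-! ### The jump system of a rate matrix -/

section RateMatrix

variable {S : Type*}

open Classical in
/-- The exit rate of each state is the sum of the rates of the jumps to the other states. -/
def HasExitRates (A : S → S → ℝ) : Prop :=
  ∀ x, A x x ≤ 0 ∧ ∑' z, (if z = x then 0 else ENNReal.ofReal (A x z)) = ENNReal.ofReal (-A x x)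

lemma IsRateMatrix.hasExitRates {A : S → S → ℝ} (hA : IsRateMatrix A) : HasExitRates A := by
  classical
  intro x
  have h1 := (hA.row_sum x).update x 0
  have h2 : ∀ z, 0 ≤ Function.update (A x) x 0 z := fun z => by
    rcases eq_or_ne z x with rfl | h
    · simp
    · simpa [Function.update_of_ne h] using hA.nonneg x z h.symm
  have h3 : ∀ z, (if z = x then 0 else ENNReal.ofReal (A x z)) =
      ENNReal.ofReal (Function.update (A x) x 0 z) := fun z => by
    rcases eq_or_ne z x with rfl | h
    · simp
    · simp [h]
  have h4 := h1.nonneg h2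
  refine ⟨by linarith, ?_⟩
  convert_to ∑' z, (if z = x then 0 else ENNReal.ofReal (A x z)) = _
  simp_rw [h3]
  rw [← ENNReal.ofReal_tsum_of_nonneg h2 h1.summable, h1.tsum_eq]
  simp

open Classical in
/-- The jump system of a rate matrix has one mark for each arrival state. -/
def jumpSystemOfMatrix (A : S → S → ℝ) (hA : HasExitRates A) : JumpSystem S S where
  rate x z := if z = x then 0 else ENNReal.ofReal (A x z)
  target _ z := z
  total x := (-A x x).toNNReal
  tsum_rate x := (hA x).2

lemma exp_total_jumpSystemOfMatrix (A : S → S → ℝ) (hA : HasExitRates A) (s : ℝ) (x : S) :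
    Real.exp (-((jumpSystemOfMatrix A hA).total x * s)) = Real.exp (s * A x x) := by
  rw [jumpSystemOfMatrix, Real.coe_toNNReal _ (by linarith [(hA x).1])]
  ring_nf

lemma firstJump_eq_firstStep (A : S → S → ℝ) (hA : HasExitRates A) (x : S) (t : ℝ)
    (u : ℝ → S → ℝ≥0∞) : firstJump A x t u = (jumpSystemOfMatrix A hA).firstStep t u x := by
  simp only [firstJump, JumpSystem.firstStep, exp_total_jumpSystemOfMatrix]
  rfl

open Classical in
lemma transProb_eq_kernel (A : S → S → ℝ) (hA : HasExitRates A) (t : ℝ) (x y : S) :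
    transProb A t x y = (jumpSystemOfMatrix A hA).kernel t x y := by
  have h0 : ∀ (t : ℝ) x, (if x = y then ENNReal.ofReal (Real.exp (t * A x x)) else 0) =
      ENNReal.ofReal (Real.exp (-((jumpSystemOfMatrix A hA).total x * t))) *
        indicator {y} (1 : S → ℝ≥0∞) x := fun t x => by
    rw [exp_total_jumpSystemOfMatrix]; simp [indicator]
  refine iSup_congr fun n => ?_
  induction n generalizing t x with
  | zero => exact h0 t x
  | succ n ih =>
    rw [transProbUpTo, JumpSystem.semigroupUpTo, firstJump_eq_firstStep A hA, ← h0,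
      show transProbUpTo A y n = _ from funext₂ ih]

end RateMatrix

/-! ### A Lyapunov function for a recurrent chain -/

section Recurrence

variable {F : Type*} {Q : F → F → ℝ} (hQ : HasExitRates Q)

/-- For a `[0, 1]`-valued solution `h` of `Q h = h`, the function `1 - h` is superharmonic with
defect `h`. -/
lemma jumpSum_one_sub_add {h : F → ℝ≥0∞} (h1 : ∀ x, h x ≤ 1)
    (hh : ∀ x, (jumpSystemOfMatrix Q hQ).jumpSum h x =
      ((jumpSystemOfMatrix Q hQ).total x + 1) * h x)
    (x : F) :
    (jumpSystemOfMatrix Q hQ).jumpSum (fun z => 1 - h z) x + h x =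
      (jumpSystemOfMatrix Q hQ).total x * (1 - h x) := by
  set J := jumpSystemOfMatrix Q hQ
  have e1 : J.jumpSum (fun z => 1 - h z) x + J.jumpSum h x = J.total x := by
    rw [← J.jumpSum_add]
    simp_rw [tsub_add_cancel_of_le (h1 _)]
    simp
  have e2 : (J.total x : ℝ≥0∞) * (1 - h x) + J.total x * h x = J.total x := by
    rw [← mul_add, tsub_add_cancel_of_le (h1 _), mul_one]
  have hfin : (J.total x : ℝ≥0∞) * h x ≠ ∞ :=
    ENNReal.mul_ne_top (by simp) (ne_top_of_le_ne_top (by simp) (h1 x))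
  rw [← ENNReal.add_left_inj hfin, e2, add_assoc, ← one_add_mul, add_comm 1, ← hh, e1]

/-- Stopping the supermartingale `1 - h` at the hitting time of `y`. -/
lemma hitProbUpTo_mul_le {h : F → ℝ≥0∞} (h1 : ∀ x, h x ≤ 1)
    (hh : ∀ x, (jumpSystemOfMatrix Q hQ).jumpSum h x =
      ((jumpSystemOfMatrix Q hQ).total x + 1) * h x)
    (y : F) (n : ℕ) {t : ℝ} (ht : 0 ≤ t) (z : F) :
    hitProbUpTo Q y n t z * (1 - h y) ≤ 1 - h z := by
  classical
  set J := jumpSystemOfMatrix Q hQ with hJ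
  induction n generalizing t z with
  | zero => by_cases hz : z = y <;> simp [hitProbUpTo, hz]
  | succ n ih =>
    by_cases hz : z = y
    · simp [hitProbUpTo, hz]
    simp only [hitProbUpTo, if_neg hz]
    rw [firstJump_eq_firstStep Q hQ]
    calc _ ≤ ∫⁻ s in Icc 0 t,
          ENNReal.ofReal (J.total z * Real.exp (-(J.total z * s))) * (1 - h z) := by
          refine (lintegral_mul_const_le _ _).trans
            (setLIntegral_mono' measurableSet_Icc fun s hs => ?_)
          rw [mul_assoc, ← J.jumpSum_mul_const, ENNReal.ofReal_mul (by positivity),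
            ENNReal.ofReal_coe_nnreal, mul_comm (J.total z : ℝ≥0∞), mul_assoc]
          gcongr
          refine (J.jumpSum_mono (fun w => ih (by linarith [hs.2]) w) z).trans ?_
          rw [← jumpSum_one_sub_add hQ h1 hh z]
          exact le_self_add
      _ ≤ _ := by
          rw [lintegral_mul_const _ (by fun_prop), lintegral_mul_exp_neg (by positivity) ht]
          refine mul_le_of_le_one_left bot_le ?_
          rw [ENNReal.ofReal_le_one]
          linarith [Real.exp_nonneg (-(J.total z * t))]

/-- A positive recurrent chain is non-explosive, in the form: the only `[0, 1]`-valued solution of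
`Q h = h` is zero. Indeed `1 - h` would be a supermartingale strictly decreasing on average between
two visits to `y`. -/
lemma eq_zero_of_isPositiveRecurrent (hrec : IsPositiveRecurrent Q) {h : F → ℝ≥0∞}
    (h1 : ∀ x, h x ≤ 1)
    (hh : ∀ x, (jumpSystemOfMatrix Q hQ).jumpSum h x =
      ((jumpSystemOfMatrix Q hQ).total x + 1) * h x)
    (y : F) : h y = 0 := by
  set J := jumpSystemOfMatrix Q hQ with hJ
  have hy := jumpSum_one_sub_add hQ h1 hh y
  rcases hrec y with h0 | hfin
  · have : J.total y = 0 := by simp [hJ, jumpSystemOfMatrix, h0]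
    rw [← hJ, this] at hy
    simpa using (add_eq_zero.1 (hy.trans (by simp))).2
  -- the supermartingale `1 - h` stopped at the first return to `y`
  have hret : ∀ t, 0 ≤ t →
      J.total y * returnTimeCDF Q y t * (1 - h y) ≤ J.jumpSum (fun z => 1 - h z) y := by
    intro t ht
    rw [returnTimeCDF, firstJump_eq_firstStep Q hQ, mul_assoc]
    calc _ ≤ J.total y * ∫⁻ s in Icc 0 t, ENNReal.ofReal (Real.exp (-(J.total y * s))) *
          J.jumpSum (fun z => 1 - h z) y := by
          gcongr
          refine (lintegral_mul_const_le _ _).trans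
            (setLIntegral_mono' measurableSet_Icc fun s hs => ?_)
          rw [mul_assoc, ← J.jumpSum_mul_const]
          gcongr
          refine J.jumpSum_mono (fun w => ?_) y
          rw [ENNReal.iSup_mul]
          exact iSup_le fun n => hitProbUpTo_mul_le hQ h1 hh y n (by linarith [hs.2]) w
      _ = ENNReal.ofReal (1 - Real.exp (-(J.total y * t))) * J.jumpSum (fun z => 1 - h z) y := by
          rw [lintegral_mul_const _ (by fun_prop), ← mul_assoc,
            ← lintegral_const_mul _ (by fun_prop), ← lintegral_mul_exp_neg (by positivity) ht]
          simp_rw [ENNReal.ofReal_mul (J.total y).coe_nonneg, ENNReal.ofReal_coe_nnreal]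
      _ ≤ _ := by
          refine mul_le_of_le_one_left bot_le ?_
          rw [ENNReal.ofReal_le_one]
          linarith [Real.exp_nonneg (-(J.total y * t))]
  -- the return to `y` is almost sure, since its time has a finite mean
  have hsmall : ∀ ε : ℝ≥0, 0 < ε → ∃ t, 0 ≤ t ∧ 1 - returnTimeCDF Q y t ≤ ε := by
    intro ε hε
    by_contra! hcon
    refine hfin.ne (top_unique ?_)
    calc (∞ : ℝ≥0∞) = ∫⁻ t in Ioi (0 : ℝ), ε := by simp [hε.ne']
      _ ≤ _ := setLIntegral_mono' measurableSet_Ioi fun t ht => (hcon t (le_of_lt ht)).le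
  have hle : ∀ ε : ℝ≥0, 0 < ε → h y ≤ ε * J.total y := by
    intro ε hε
    rw [mul_comm]
    obtain ⟨t, ht, hε⟩ := hsmall ε hε
    have hf : (J.total y : ℝ≥0∞) * (1 - h y) ≠ ∞ :=
      ENNReal.mul_ne_top (by simp) (ne_top_of_le_ne_top ENNReal.one_ne_top tsub_le_self)
    refine (ENNReal.add_le_add_iff_left hf).1 ?_
    rw [tsub_le_iff_left] at hε
    calc (J.total y : ℝ≥0∞) * (1 - h y) + h y
        ≤ J.total y * ((returnTimeCDF Q y t + ε) * (1 - h y)) + h y := by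
          gcongr
          exact le_mul_of_one_le_left bot_le hε
      _ = (J.total y * returnTimeCDF Q y t * (1 - h y) + h y) + J.total y * (ε * (1 - h y)) := by
          ring
      _ ≤ (J.jumpSum (fun z => 1 - h z) y + h y) + J.total y * (ε * 1) := by
          gcongr
          · exact hret t ht
          · exact tsub_le_self
      _ = _ := by rw [hy, mul_one]
  exact eq_zero_of_forall_le_mul ENNReal.coe_ne_top hle

open Classical in
/-- `escapeTransform f n x` is an upper bound for the Laplace transform at `1` of the exit time from
`{f < n}`; it decreases with `n` to a solution of `Q h = h`. -/
def escapeTransform (f : F → ℕ) : ℕ → F → ℝ≥0∞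
  | 0, _ => 1
  | n + 1, x => if f x ≤ n then
      (jumpSystemOfMatrix Q hQ).jumpSum (escapeTransform f n) x /
        ((jumpSystemOfMatrix Q hQ).total x + 1) else 1

variable (f : F → ℕ)

lemma escapeTransform_le_one (n : ℕ) (x : F) : escapeTransform hQ f n x ≤ 1 := by
  induction n generalizing x with
  | zero => exact le_rfl
  | succ n ih =>
    rw [escapeTransform]
    split_ifs
    · refine ENNReal.div_le_of_le_mul ?_
      refine ((jumpSystemOfMatrix Q hQ).jumpSum_mono ih x).trans ?_
      rw [JumpSystem.jumpSum_const, mul_one, one_mul]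
      exact le_self_add
    · exact le_rfl

lemma antitone_escapeTransform (x : F) : Antitone fun n => escapeTransform hQ f n x := by
  refine antitone_nat_of_succ_le fun n => ?_
  induction n generalizing x with
  | zero => exact escapeTransform_le_one hQ f 1 x
  | succ n ih =>
    by_cases h : f x ≤ n
    · rw [escapeTransform, escapeTransform, if_pos h, if_pos (h.trans n.le_succ)]
      exact ENNReal.div_le_div_right ((jumpSystemOfMatrix Q hQ).jumpSum_mono ih x) _
    · refine (escapeTransform_le_one hQ f _ x).trans ?_
      rw [escapeTransform, if_neg h]

lemma escapeTransform_eq_one {n : ℕ} {x : F} (h : n ≤ f x) : escapeTransform hQ f n x = 1 := by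
  cases n with
  | zero => rfl
  | succ n => rw [escapeTransform, if_neg (by omega)]

lemma total_add_one_mul_escapeTransform {n : ℕ} {x : F} (h : f x ≤ n) :
    ((jumpSystemOfMatrix Q hQ).total x + 1) * escapeTransform hQ f (n + 1) x =
      (jumpSystemOfMatrix Q hQ).jumpSum (escapeTransform hQ f n) x := by
  rw [escapeTransform, if_pos h]
  exact ENNReal.mul_div_cancel (by simp) (by simp)

lemma jumpSum_escapeTransform_le (n : ℕ) (x : F) :
    (jumpSystemOfMatrix Q hQ).jumpSum (escapeTransform hQ f n) x ≤
      ((jumpSystemOfMatrix Q hQ).total x + 1) * escapeTransform hQ f n x := by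
  by_cases h : n ≤ f x
  · refine ((jumpSystemOfMatrix Q hQ).jumpSum_mono (escapeTransform_le_one hQ f n) x).trans ?_
    rw [JumpSystem.jumpSum_const, escapeTransform_eq_one hQ f h, mul_one, mul_one]
    exact le_self_add
  · obtain ⟨m, rfl⟩ : ∃ m, n = m + 1 := ⟨n - 1, by omega⟩
    rw [total_add_one_mul_escapeTransform hQ f (by omega)]
    exact (jumpSystemOfMatrix Q hQ).jumpSum_mono
      (fun z => antitone_escapeTransform hQ f z m.le_succ) x

lemma tendsto_escapeTransform [Countable F] (hrec : IsPositiveRecurrent Q) (x : F) :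
    Tendsto (fun n => escapeTransform hQ f n x) atTop (𝓝 0) := by
  set J := jumpSystemOfMatrix Q hQ with hJ
  set e := escapeTransform hQ f with he
  have hanti := antitone_escapeTransform hQ f
  have hlim : ∀ z, Tendsto (fun n => e n z) atTop (𝓝 (⨅ n, e n z)) :=
    fun z => tendsto_atTop_iInf (hanti z)
  have hJlim : ∀ z, Tendsto (fun n => J.jumpSum (e n) z) atTop
      (𝓝 (J.jumpSum (fun w => ⨅ n, e n w) z)) := by
    intro z
    let _ : MeasurableSpace F := ⊤
    simp only [JumpSystem.jumpSum, ← lintegral_count]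
    refine tendsto_lintegral_of_dominated_convergence (fun w => J.rate z w)
      (fun n => measurable_from_top) (fun n => Eventually.of_forall fun w => ?_) ?_
      (Eventually.of_forall fun w => ?_)
    · exact mul_le_of_le_one_right bot_le (escapeTransform_le_one hQ f n _)
    · rw [lintegral_count, J.tsum_rate]
      simp
    · exact ENNReal.Tendsto.const_mul (hlim _) (Or.inr (ne_top_of_le_ne_top
        (by rw [J.tsum_rate]; simp) (ENNReal.le_tsum w)))
  have hz := eq_zero_of_isPositiveRecurrent hQ hrec (h := fun z => ⨅ n, e n z)
    (fun z => (iInf_le _ 0).trans (escapeTransform_le_one hQ f 0 z)) (fun z => ?_) x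
  · rw [← hz]; exact hlim x
  · refine tendsto_nhds_unique (hJlim z) ?_
    have h1 := ENNReal.Tendsto.const_mul (a := ((J.total z : ℝ≥0∞) + 1))
      ((tendsto_add_atTop_iff_nat 1).2 (hlim z)) (Or.inr (by simp))
    refine h1.congr' ?_
    filter_upwards [eventually_ge_atTop (f z)] with n hn
    exact total_add_one_mul_escapeTransform hQ f hn

/-- A positive recurrent chain has a Lyapunov function with finite sublevel sets, which certifies
that it does not explode in a form that passes to the particle system and to the coupling. -/
lemma exists_lyapunov [Countable F] (hrec : IsPositiveRecurrent Q) :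
    ∃ V : F → ℝ≥0∞, (∀ x, V x ≠ ∞) ∧ (∀ r : ℝ≥0, {x | V x ≤ r}.Finite) ∧
      ∀ x, (jumpSystemOfMatrix Q hQ).jumpSum V x ≤
        ((jumpSystemOfMatrix Q hQ).total x + 1) * V x := by
  -- sum a subsequence of the escape transforms that converges fast on each finite set
  obtain ⟨f, hf⟩ := exists_injective_nat F
  have hfin : ∀ k, {x | f x ≤ k}.Finite := fun k =>
    (finite_Iic k).preimage hf.injOn
  have hex : ∀ k : ℕ, ∃ n, ∀ x, f x ≤ k → escapeTransform hQ f n x ≤ 2⁻¹ ^ k := by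
    intro k
    have : ∀ᶠ n in atTop, ∀ x ∈ {x | f x ≤ k}, escapeTransform hQ f n x ≤ 2⁻¹ ^ k := by
      rw [(hfin k).eventually_all]
      intro x _
      exact (tendsto_escapeTransform hQ f hrec x).eventually_le_const
        (ENNReal.pow_pos (by simp) k)
    exact this.exists
  choose n hn using hex
  refine ⟨fun x => ∑' k, escapeTransform hQ f (n k) x, fun x => ?_, fun r => ?_, fun x => ?_⟩
  · have hle : ∀ k, escapeTransform hQ f (n k) x ≤
        (if k ∈ Finset.range (f x) then 1 else 0) + 2⁻¹ ^ k := by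
      intro k
      by_cases hk : f x ≤ k
      · exact le_add_left (hn k x hk)
      · rw [if_pos (by simpa using hk)]
        exact le_add_right (escapeTransform_le_one hQ f _ x)
    refine ne_top_of_le_ne_top ?_ (ENNReal.tsum_le_tsum hle)
    rw [ENNReal.tsum_add, ENNReal.tsum_geometric]
    refine ENNReal.add_ne_top.2 ⟨?_, by simp⟩
    rw [tsum_eq_sum (s := Finset.range (f x)) (fun k hk => if_neg hk)]
    exact ENNReal.sum_ne_top.2 fun k _ => by
      split_ifs
      exact ENNReal.one_ne_top
  · obtain ⟨m, hm⟩ := exists_nat_gt r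
    refine (hfin ((Finset.range m).sup n)).subset fun x hx => ?_
    by_contra hcon
    simp only [mem_ofPred_eq, not_le] at hcon hx
    have : (m : ℝ≥0∞) ≤ r := by
      refine le_trans ?_ hx
      refine le_trans ?_ (ENNReal.sum_le_tsum (Finset.range m))
      rw [Finset.sum_congr rfl fun k hk => escapeTransform_eq_one hQ f
        ((Finset.le_sup hk).trans hcon.le)]
      simp
    exact absurd (by exact_mod_cast this) (not_le.2 hm)
  · rw [JumpSystem.jumpSum_tsum, ← ENNReal.tsum_mul_left]
    exact ENNReal.tsum_le_tsum fun k => jumpSum_escapeTransform_le hQ f (n k) x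

end Recurrence

/-! ### Configurations -/

section Configurations

variable {F : Type*} {N : ℕ}

instance [Countable F] : Countable (Config F N) :=
  inferInstanceAs (Countable {η : F →₀ ℕ // η.degree = N})

instance : DiscreteMeasurableSpace (Config F N) := ⟨fun _ => trivial⟩

lemma tsum_coe_eq_degree (f : F →₀ ℕ) : ∑' i, (f i : ℝ≥0∞) = (f.degree : ℝ≥0∞) := by
  rw [tsum_eq_sum (s := f.support) (fun i hi => by simpa using hi), Finsupp.degree_apply]
  push_cast
  rfl

lemma Config.tsum_coe (η : Config F N) : ∑' i, (η i : ℝ≥0∞) = N := by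
  rw [tsum_coe_eq_degree, η.2]

lemma Config.coe_move {η : Config F N} {i : F} (h : η i ≠ 0) (j : F) :
    (η.move i j).1 = η.1 - Finsupp.single i 1 + Finsupp.single j 1 :=
  congrArg Subtype.val (dif_pos h)

lemma Config.coe_move_add {η : Config F N} {i : F} (h : η i ≠ 0) (j : F) :
    (η.move i j).1 + Finsupp.single i 1 = η.1 + Finsupp.single j 1 := by
  rw [coe_move h, add_right_comm, tsub_add_cancel_of_le]
  rw [Finsupp.single_le_iff]
  exact Nat.one_le_iff_ne_zero.2 h

@[simp] lemma Config.move_self (η : Config F N) (i : F) : η.move i i = η := by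
  by_cases h : η i ≠ 0
  · exact Subtype.ext (add_right_cancel (coe_move_add h i))
  · exact dif_neg h

/-- The number of particles that have to be moved to turn `η` into `η'`. -/
def Config.transportDist (η η' : Config F N) : ℕ := (η.1 - η'.1).degree

/-- The distance is symmetric because both configurations have `N` particles. -/
lemma Config.transportDist_comm (η η' : Config F N) :
    η.transportDist η' = η'.transportDist η := by
  have h : η.1 + (η'.1 - η.1) = η'.1 + (η.1 - η'.1) := by
    ext i
    simp only [Finsupp.add_apply, Finsupp.tsub_apply]
    omega
  have := congrArg Finsupp.degree h
  rw [map_add, map_add, η.2, η'.2] at this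
  exact (Nat.add_left_cancel this).symm

lemma Config.transportDist_le (η η' : Config F N) : η.transportDist η' ≤ N := by
  have h := congrArg Finsupp.degree
    (tsub_add_cancel_of_le (tsub_le_self : η.1 - η'.1 ≤ η.1))
  rw [map_add, η.2] at h
  rw [transportDist]
  omega

lemma Config.transportDist_eq_zero {η η' : Config F N} : η.transportDist η' = 0 ↔ η = η' := by
  constructor
  · intro h
    have h' : η'.transportDist η = 0 := by rwa [transportDist_comm]
    rw [transportDist, Finsupp.degree_eq_zero_iff, tsub_eq_zero_iff_le] at h h'
    exact Subtype.ext (le_antisymm h h')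
  · rintro rfl
    simp [transportDist]

lemma ofReal_d₁ (η η' : Config F N) : ENNReal.ofReal (d₁ η η') = η.transportDist η' := by
  have h : d₁ η η' = η.transportDist η' := by
    have h1 : ∀ f : F →₀ ℕ, HasSum (fun i => (f i : ℝ)) (f.degree : ℝ) := fun f => by
      have : HasSum (fun i => (f i : ℝ)) (∑ i ∈ f.support, (f i : ℝ)) :=
        hasSum_sum_of_ne_finset_zero fun i hi => by simpa using hi
      rw [Finsupp.degree_apply]
      exact_mod_cast this
    have h2 := (h1 (η.1 - η'.1)).add (h1 (η'.1 - η.1))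
    have h3 : (fun j => |(η j : ℝ) - (η' j : ℝ)|) =
        fun i => (((η.1 - η'.1) i : ℕ) : ℝ) + (((η'.1 - η.1) i : ℕ) : ℝ) := by
      ext j
      rw [Finsupp.tsub_apply, Finsupp.tsub_apply]
      rcases le_total (η j) (η' j) with h | h
      · rw [Nat.sub_eq_zero_of_le h, Nat.cast_sub h, abs_of_nonpos (by simpa using h)]
        simp
      · rw [Nat.sub_eq_zero_of_le h, Nat.cast_sub h, abs_of_nonneg (by simpa using h)]
        simp
    have h4 : (((η'.1 - η.1).degree : ℕ) : ℝ) = ((η.1 - η'.1).degree : ℕ) := by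
      exact_mod_cast Config.transportDist_comm η' η
    rw [d₁, h3, h2.tsum_eq, h4, Config.transportDist]
    ring
  rw [h, ENNReal.ofReal_natCast]

/-- The transport distance after moving a particle of a pair `(i, i')`, which is either common to
both configurations or made of two excess particles, to a pair `(j, j')`. -/
lemma Config.transportDist_move_le {η η' : Config F N} {i i' : F} (hi : η i ≠ 0) (hi' : η' i' ≠ 0)
    (h : i = i' ∨ (η' i < η i ∧ η i' < η' i')) (j j' : F) [Decidable (i = i')]
    [Decidable (j = j')] :
    (η.move i j).transportDist (η'.move i' j') + (if i = i' then 0 else 1) ≤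
      η.transportDist η' + (if j = j' then 0 else 1) := by
  classical
  have hadd : (η.move i j).1 - (η'.move i' j').1 ≤
      ((η.1 - Finsupp.single i 1) - (η'.1 - Finsupp.single i' 1)) +
        (Finsupp.single j 1 - Finsupp.single j' 1) := by
    rw [coe_move hi, coe_move hi']
    intro k
    simp only [Finsupp.add_apply, Finsupp.tsub_apply]
    omega
  have hj : (Finsupp.single j 1 - Finsupp.single j' 1 : F →₀ ℕ).degree ≤
      if j = j' then 0 else 1 := by
    split_ifs with hjj
    · simp [hjj]
    · refine (Finsupp.degree_mono tsub_le_self).trans ?_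
      simp
  have hrem : ((η.1 - Finsupp.single i 1) - (η'.1 - Finsupp.single i' 1)).degree +
      (if i = i' then 0 else 1) ≤ η.transportDist η' := by
    split_ifs with hii
    · subst hii
      refine Finsupp.degree_mono fun k => ?_
      simp only [Finsupp.tsub_apply]
      omega
    · obtain ⟨h1, h2⟩ := h.resolve_left hii
      have := Finsupp.degree_mono (R := ℕ) (show (η.1 - Finsupp.single i 1) -
        (η'.1 - Finsupp.single i' 1) + Finsupp.single i 1 ≤ η.1 - η'.1 from fun k => by
          simp only [Finsupp.add_apply, Finsupp.tsub_apply, Finsupp.single_apply]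
          split_ifs with hk hk' hk'
          · exact absurd (hk.trans hk'.symm) hii
          · subst hk; omega
          · subst hk'; omega
          · omega)
      rw [map_add, Finsupp.degree_single] at this
      exact this
  have := (Finsupp.degree_mono hadd).trans (map_add _ _ _).le
  rw [transportDist]
  omega

end Configurations

/-! ### The particle system as a jump system -/

section Particles

variable {F : Type*} {N : ℕ} (a : F → F → ℝ≥0∞) (p : F → ℝ≥0)

/-- The rate at which a particle at `i` jumps to `j`. -/
def particleRate (η : Config F N) (i j : F) : ℝ≥0∞ :=
  a i j + p i * (η j / ((N - 1 : ℕ) : ℝ≥0∞))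

lemma tsum_particleRate (η : Config F N) (i : F) :
    ∑' j, particleRate a p η i j = ∑' j, a i j + p i * (N / ((N - 1 : ℕ) : ℝ≥0∞)) := by
  simp_rw [particleRate, ENNReal.tsum_add, ENNReal.tsum_mul_left, div_eq_mul_inv,
    ENNReal.tsum_mul_right, η.tsum_coe]

lemma natCast_div_ne_top (hN : 2 ≤ N) (n : ℕ) : (n : ℝ≥0∞) / ((N - 1 : ℕ) : ℝ≥0∞) ≠ ∞ :=
  ENNReal.div_ne_top (by simp) (Nat.cast_ne_zero.2 (by omega))

variable {a}

lemma tsum_particleRate_ne_top (ha : ∀ i, ∑' j, a i j ≠ ∞) (hN : 2 ≤ N) (η : Config F N) (i : F) :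
    ∑' j, particleRate a p η i j ≠ ∞ := by
  rw [tsum_particleRate]
  exact ENNReal.add_ne_top.2 ⟨ha i, ENNReal.mul_ne_top (by simp) (natCast_div_ne_top hN N)⟩

lemma tsum_config_mul_ne_top (η : Config F N) {f : F → ℝ≥0∞} (hf : ∀ i, f i ≠ ∞) :
    ∑' i, η i * f i ≠ ∞ := by
  rw [tsum_eq_sum (s := η.1.support) (fun i hi => by
    rw [Finsupp.notMem_support_iff.1 hi]; simp)]
  exact ENNReal.sum_ne_top.2 fun i _ => ENNReal.mul_ne_top (by simp) (hf i)

/-- The Fleming-Viot particle system, with one mark for each pair of sites. -/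
def particleSystem (ha : ∀ i, ∑' j, a i j ≠ ∞) (hN : 2 ≤ N) : JumpSystem (Config F N) (F × F) where
  rate η m := η m.1 * particleRate a p η m.1 m.2
  target η m := η.move m.1 m.2
  total η := (∑' m : F × F, η m.1 * particleRate a p η m.1 m.2).toNNReal
  tsum_rate η := by
    rw [ENNReal.coe_toNNReal]
    rw [ENNReal.tsum_prod (f := fun i j => η i * particleRate a p η i j)]
    simp_rw [ENNReal.tsum_mul_left]
    exact tsum_config_mul_ne_top η fun i => tsum_particleRate_ne_top p ha hN η i

lemma jumpSum_particleSystem (ha : ∀ i, ∑' j, a i j ≠ ∞) (hN : 2 ≤ N) (φ : Config F N → ℝ≥0∞)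
    (η : Config F N) : (particleSystem p ha hN).jumpSum φ η =
      ∑' i, η i * ∑' j, particleRate a p η i j * φ (η.move i j) := by
  change ∑' m : F × F, (η m.1 * particleRate a p η m.1 m.2) * φ (η.move m.1 m.2) = _
  rw [ENNReal.tsum_prod (f := fun i j => (η i * particleRate a p η i j) * φ (η.move i j))]
  simp_rw [mul_assoc, ENNReal.tsum_mul_left]

/-- The sum of `V` over all the particles. -/
def particleSum (V : F → ℝ≥0∞) (f : F →₀ ℕ) : ℝ≥0∞ := ∑' i, f i * V i

lemma particleSum_add_single (V : F → ℝ≥0∞) (f : F →₀ ℕ) (i : F) :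
    particleSum V (f + Finsupp.single i 1) = particleSum V f + V i := by
  classical
  simp only [particleSum, Finsupp.add_apply, Nat.cast_add, add_mul, ENNReal.tsum_add]
  congr 1
  rw [tsum_eq_single i fun j hj => by simp [hj.symm]]
  simp

/-- Summing a Lyapunov function of the one-particle motion over the particles gives a Lyapunov
function of the particle system: deaths cost at most `sup p` times the total. -/
lemma jumpSum_particleSum_le (ha : ∀ i, ∑' j, a i j ≠ ∞) (hN : 2 ≤ N) {V : F → ℝ≥0∞}
    (hV : ∀ i, V i ≠ ∞) (hLV : ∀ i, ∑' j, a i j * V j ≤ (∑' j, a i j + 1) * V i)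
    {s : ℝ≥0} (hs : ∀ i, p i ≤ s) (η : Config F N) :
    (particleSystem p ha hN).jumpSum (fun η => particleSum V η.1) η ≤
      ((particleSystem p ha hN).total η +
        (1 + s * (N / ((N - 1 : ℕ) : ℝ≥0∞)))) * particleSum V η.1 := by
  set w := fun i => ∑' j, particleRate a p η i j with hw
  have hwfin : ∀ i, w i ≠ ∞ := tsum_particleRate_ne_top p ha hN η
  have htot : ((particleSystem p ha hN).total η : ℝ≥0∞) = ∑' i, η i * w i := by
    have := (particleSystem p ha hN).jumpSum_const 1 η
    rw [mul_one] at this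
    rw [← this, jumpSum_particleSystem]
    simp [hw]
  have hcancel : ∑' i, η i * (w i * V i) ≠ ∞ :=
    tsum_config_mul_ne_top η fun i => ENNReal.mul_ne_top (hwfin i) (hV i)
  -- moving a particle from `i` to `j` replaces `V i` by `V j` in the total
  have hmove : (particleSystem p ha hN).jumpSum (fun η => particleSum V η.1) η +
      ∑' i, η i * (w i * V i) =
        ∑' i, η i * (w i * particleSum V η.1 + ∑' j, particleRate a p η i j * V j) := by
    rw [jumpSum_particleSystem, ← ENNReal.tsum_add]
    refine tsum_congr fun i => ?_
    rw [← mul_add]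
    by_cases h : η i = 0
    · simp [h]
    congr 1
    rw [hw]
    simp_rw [← ENNReal.tsum_mul_right]
    rw [← ENNReal.tsum_add, ← ENNReal.tsum_add]
    refine tsum_congr fun j => ?_
    rw [← mul_add, ← mul_add, ← particleSum_add_single, ← particleSum_add_single,
      Config.coe_move_add h]
  have hVsum : ∀ i, ∑' j, particleRate a p η i j * V j ≤
      w i * V i + (V i + s * (particleSum V η.1 / ((N - 1 : ℕ) : ℝ≥0∞))) := by
    intro i
    simp_rw [particleRate, add_mul, ENNReal.tsum_add]
    have h1 : ∑' j, p i * (η j / ((N - 1 : ℕ) : ℝ≥0∞)) * V j ≤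
        s * (particleSum V η.1 / ((N - 1 : ℕ) : ℝ≥0∞)) := by
      simp_rw [mul_assoc, ENNReal.tsum_mul_left, div_eq_mul_inv, mul_right_comm _ _ (V _)]
      rw [ENNReal.tsum_mul_right]
      gcongr
      · exact_mod_cast hs i
      · exact le_rfl
    have h2 : ∑' j, a i j ≤ w i := ENNReal.tsum_le_tsum fun j => le_self_add
    calc _ ≤ (∑' j, a i j + 1) * V i + s * (particleSum V η.1 / ((N - 1 : ℕ) : ℝ≥0∞)) :=
          add_le_add (hLV i) h1
      _ ≤ (w i + 1) * V i + s * (particleSum V η.1 / ((N - 1 : ℕ) : ℝ≥0∞)) := by gcongr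
      _ = _ := by ring
  refine (ENNReal.add_le_add_iff_right hcancel).1 (hmove.trans_le ?_)
  calc _ ≤ ∑' i, η i * (w i * particleSum V η.1 +
        (w i * V i + (V i + s * (particleSum V η.1 / ((N - 1 : ℕ) : ℝ≥0∞))))) :=
        ENNReal.tsum_le_tsum fun i => by gcongr; exact hVsum i
    _ = _ := by
        simp_rw [mul_add, ENNReal.tsum_add, ← mul_assoc, ENNReal.tsum_mul_right]
        rw [← htot, η.tsum_coe, show ∑' i, (η i : ℝ≥0∞) * V i = particleSum V η.1 from rfl]
        simp only [div_eq_mul_inv]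
        ring

/-- Only finitely many configurations live on a finite set of sites. -/
lemma finite_particleSum_le {V : F → ℝ≥0∞} (hV : ∀ r : ℝ≥0, {i | V i ≤ r}.Finite) (r : ℝ≥0) :
    {η : Config F N | particleSum V η.1 ≤ r}.Finite := by
  classical
  set K := (hV r).toFinset
  have h : (Iic (∑ i ∈ K, Finsupp.single i N)).Finite := by
    rw [← Icc_bot]; exact finite_Icc _ _
  have h' : ((fun η : Config F N => η.1) ⁻¹' Iic (∑ i ∈ K, Finsupp.single i N)).Finite :=
    h.preimage Subtype.val_injective.injOn
  refine h'.subset fun η hη i => ?_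
  rcases Nat.eq_zero_or_pos (η i) with h0 | h0
  · exact h0.le.trans (Nat.zero_le _)
  have hVi : V i ≤ r := by
    calc V i ≤ η i * V i := le_mul_of_one_le_left bot_le (by exact_mod_cast h0)
      _ ≤ particleSum V η.1 := ENNReal.le_tsum i
      _ ≤ r := hη
  have hle : η i ≤ N := by
    have := ENNReal.le_tsum (f := fun i => (η i : ℝ≥0∞)) i
    rw [η.tsum_coe] at this
    exact_mod_cast this
  calc η i ≤ N := hle
    _ = Finsupp.single i N i := by simp
    _ ≤ (∑ i ∈ K, Finsupp.single i N) i := by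
      rw [Finsupp.finsetSum_apply]
      exact Finset.single_le_sum (f := fun j => Finsupp.single j N i) (fun _ _ => Nat.zero_le _)
        (by simpa [K] using hVi)

end Particles

/-! ### The rate matrix of the particle system -/

section Generator

variable {F : Type*} {N : ℕ} {Q : F → F → ℝ} (p₀ : F → ℝ)

lemma jumpRate_ne_top (hQ : IsRateMatrix Q) (i : F) :
    ∑' j, (jumpSystemOfMatrix Q hQ.hasExitRates).rate i j ≠ ∞ := by
  rw [JumpSystem.tsum_rate]; simp

/-- The Fleming-Viot particle system of the rate matrix `Q` and the death rate `p₀`. -/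
abbrev flemingViotSystem (hQ : IsRateMatrix Q) (hN : 2 ≤ N) : JumpSystem (Config F N) (F × F) :=
  particleSystem (fun i => (p₀ i).toNNReal) (jumpRate_ne_top hQ) hN

variable {p₀} (hQ : IsRateMatrix Q)

/-- The generator of a function vanishing at `η` is a sum over jumps of non-negative terms. -/
lemma ofReal_generator (hp₀ : ∀ i, 0 ≤ p₀ i) (hN : 2 ≤ N) {g : Config F N → ℝ}
    (hg0 : ∀ ζ, 0 ≤ g ζ) (hg1 : ∀ ζ, g ζ ≤ 1) {η : Config F N} (hη : g η = 0) :
    0 ≤ generator Q p₀ N g η ∧ ENNReal.ofReal (generator Q p₀ N g η) =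
      (flemingViotSystem p₀ hQ hN).jumpSum (fun ζ => ENNReal.ofReal (g ζ)) η := by
  classical
  have hN' : (0 : ℝ) < (N : ℝ) - 1 := by
    have : (2 : ℝ) ≤ N := by exact_mod_cast hN
    linarith
  have hNcast : ((N : ℝ) - 1) = ((N - 1 : ℕ) : ℝ) := by
    rw [Nat.cast_sub (by omega)]; simp
  set r : F → F → ℝ := fun i j =>
    (g (η.move i j) - g η) * (Q i j + p₀ i * ((η j : ℝ) / ((N : ℝ) - 1))) with hr
  have hr0 : ∀ i j, 0 ≤ r i j := fun i j => by
    rcases eq_or_ne i j with rfl | hij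
    · simp [hr]
    · have := hQ.nonneg i j hij
      have := hp₀ i
      have := hg0 (η.move i j)
      simp only [hr, hη, sub_zero]
      positivity
  have hsum : ∀ i, Summable (r i) := fun i => by
    have h1 : Summable fun j => Q i j + p₀ i * ((η j : ℝ) / ((N : ℝ) - 1)) := by
      refine (hQ.row_sum i).summable.add (Summable.mul_left _ ?_)
      refine summable_of_ne_finset_zero (s := η.1.support) fun j hj => ?_
      rw [Finsupp.notMem_support_iff.1 hj]; simp
    refine Summable.of_norm_bounded h1.norm fun j => ?_
    simp only [hr, hη, sub_zero, norm_mul]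
    refine mul_le_of_le_one_left (norm_nonneg _) ?_
    rw [Real.norm_of_nonneg (hg0 _)]
    exact hg1 _
  have hrr : ∀ i j, ENNReal.ofReal (r i j) = particleRate
      (fun i j => (jumpSystemOfMatrix Q hQ.hasExitRates).rate i j) (fun i => (p₀ i).toNNReal) η i j *
        ENNReal.ofReal (g (η.move i j)) := fun i j => by
    rcases eq_or_ne j i with rfl | hij
    · simp [hr, hη]
    · have h1 := hQ.nonneg i j hij.symm
      have h2 := hp₀ i
      simp only [hr, hη, sub_zero, particleRate, jumpSystemOfMatrix, if_neg hij]
      rw [mul_comm, ENNReal.ofReal_mul (by positivity), ENNReal.ofReal_add h1 (by positivity),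
        ENNReal.ofReal_mul h2, ENNReal.ofReal_div_of_pos hN', hNcast, ENNReal.ofReal_natCast,
        ENNReal.ofReal_natCast]
      rfl
  have hin : ∀ i, 0 ≤ (η i : ℝ) * ∑' j, r i j := fun i =>
    mul_nonneg (by positivity) (tsum_nonneg (hr0 i))
  refine ⟨tsum_nonneg hin, ?_⟩
  rw [jumpSum_particleSystem, generator, ENNReal.ofReal_tsum_of_nonneg hin]
  · refine tsum_congr fun i => ?_
    rw [ENNReal.ofReal_mul (by positivity), ENNReal.ofReal_natCast,
      ENNReal.ofReal_tsum_of_nonneg (hr0 i) (hsum i)]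
    simp_rw [hrr]
  · refine summable_of_ne_finset_zero (s := η.1.support) fun j hj => ?_
    rw [Finsupp.notMem_support_iff.1 hj]; simp

lemma ofReal_rateMatrix (hp₀ : ∀ i, 0 ≤ p₀ i) (hN : 2 ≤ N) {η ζ : Config F N} (h : ζ ≠ η) :
    ENNReal.ofReal (rateMatrix Q p₀ N η ζ) =
      (flemingViotSystem p₀ hQ hN).jumpSum (indicator {ζ} 1) η := by
  have := (ofReal_generator hQ hp₀ hN (g := indicator {ζ} 1) (η := η)
    (fun _ => indicator_nonneg (fun _ _ => zero_le_one) _)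
    (fun _ => indicator_le_self' (fun _ _ => zero_le_one) _)
    (by simpa [indicator] using h.symm)).2
  rw [rateMatrix, this]
  congr 1
  ext ξ
  by_cases hξ : ξ = ζ <;> simp [hξ]

lemma rateMatrix_self (hp₀ : ∀ i, 0 ≤ p₀ i) (hN : 2 ≤ N) (η : Config F N) :
    rateMatrix Q p₀ N η η ≤ 0 ∧ ENNReal.ofReal (-rateMatrix Q p₀ N η η) =
      (flemingViotSystem p₀ hQ hN).jumpSum (indicator {η}ᶜ 1) η := by
  have h := ofReal_generator hQ hp₀ hN (g := indicator {η}ᶜ 1) (η := η)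
    (fun _ => indicator_nonneg (fun _ _ => zero_le_one) _)
    (fun _ => indicator_le_self' (fun _ _ => zero_le_one) _)
    (by simp)
  have hneg : generator Q p₀ N (indicator {η}ᶜ 1) η = -rateMatrix Q p₀ N η η := by
    rw [rateMatrix, generator, generator, ← tsum_neg]
    refine tsum_congr fun i => ?_
    rw [← mul_neg, ← tsum_neg]
    congr 1
    refine tsum_congr fun j => ?_
    by_cases hη : η.move i j = η <;> simp [hη]
  rw [hneg] at h
  refine ⟨by linarith [h.1], h.2.trans ?_⟩
  congr 1
  ext ξ
  by_cases hξ : ξ = η <;> simp [hξ]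

lemma JumpSystem.jumpSum_eq_tsum {S M : Type*} (J : JumpSystem S M) (φ : S → ℝ≥0∞) (x : S) :
    J.jumpSum φ x = ∑' z, J.jumpSum (indicator {z} 1) x * φ z := by
  simp_rw [← J.jumpSum_mul_const]
  rw [← J.jumpSum_tsum]
  congr 1
  ext y
  rw [tsum_eq_single y fun z hz => by simp [indicator, hz.symm]]
  simp

open Classical in
lemma tsum_rateMatrix_mul (hp₀ : ∀ i, 0 ≤ p₀ i) (hN : 2 ≤ N) (φ : Config F N → ℝ≥0∞)
    (η : Config F N) :
    ∑' ζ, (if ζ = η then 0 else ENNReal.ofReal (rateMatrix Q p₀ N η ζ)) * φ ζ =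
      (flemingViotSystem p₀ hQ hN).jumpSum (indicator {η}ᶜ φ) η := by
  rw [JumpSystem.jumpSum_eq_tsum]
  refine tsum_congr fun ζ => ?_
  by_cases h : ζ = η
  · simp [h]
  · rw [if_neg h, ofReal_rateMatrix hQ hp₀ hN h, indicator_of_mem (by simpa using h)]

lemma hasExitRates_rateMatrix (hQ : IsRateMatrix Q) (hp₀ : ∀ i, 0 ≤ p₀ i) (hN : 2 ≤ N) :
    HasExitRates (rateMatrix Q p₀ N) := fun η => by
  obtain ⟨h1, h2⟩ := rateMatrix_self hQ hp₀ hN η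
  refine ⟨h1, ?_⟩
  rw [h2, ← tsum_rateMatrix_mul hQ hp₀ hN 1]
  simp

/-- The marks of the particle system account for the jumps of the rate matrix, and for moves
that leave the configuration unchanged. -/
lemma jumpSum_flemingViotSystem (hp₀ : ∀ i, 0 ≤ p₀ i) (hN : 2 ≤ N) (φ : Config F N → ℝ≥0∞)
    (η : Config F N) :
    (flemingViotSystem p₀ hQ hN).jumpSum φ η =
      (jumpSystemOfMatrix _ (hasExitRates_rateMatrix hQ hp₀ hN)).jumpSum φ η +
        (flemingViotSystem p₀ hQ hN).jumpSum (indicator {η} 1) η * φ η := by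
  have h : (jumpSystemOfMatrix _ (hasExitRates_rateMatrix hQ hp₀ hN)).jumpSum φ η =
      (flemingViotSystem p₀ hQ hN).jumpSum (indicator {η}ᶜ φ) η :=
    tsum_rateMatrix_mul hQ hp₀ hN φ η
  rw [h, ← JumpSystem.jumpSum_mul_const, ← JumpSystem.jumpSum_add]
  congr 1
  ext ξ
  by_cases hξ : ξ = η <;> simp [hξ]

end Generator

/-! ### The coupling -/

section Coupling

variable {F : Type*} {N : ℕ}

open Classical in
/-- The mass of pairs of particles at `(i, i')` when the particles of `η` are paired with those of
`η'`: common particles are paired together, and the excess particles of `η` are paired with the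
excess particles of `η'` proportionally. -/
def pairing (η η' : Config F N) (i i' : F) : ℝ≥0∞ :=
  (if i = i' then ((min (η i) (η' i) : ℕ) : ℝ≥0∞) else 0) +
    ((η.1 - η'.1) i : ℝ≥0∞) * ((η'.1 - η.1) i' : ℝ≥0∞) / η.transportDist η'

lemma pairing_comm (η η' : Config F N) (i i' : F) : pairing η η' i i' = pairing η' η i' i := by
  rw [pairing, pairing, mul_comm (((η.1 - η'.1) i : ℕ) : ℝ≥0∞), Config.transportDist_comm]
  congr 1
  by_cases h : i = i'
  · subst h; simp [min_comm]
  · rw [if_neg h, if_neg (Ne.symm h)]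

lemma tsum_pairing (η η' : Config F N) (i : F) : ∑' i', pairing η η' i i' = η i := by
  classical
  simp_rw [pairing, ENNReal.tsum_add, div_eq_mul_inv, ENNReal.tsum_mul_right,
    ENNReal.tsum_mul_left]
  rw [tsum_eq_single i fun j hj => if_neg hj.symm, if_pos rfl, tsum_coe_eq_degree,
    ← Config.transportDist, ← Config.transportDist_comm]
  rcases Nat.eq_zero_or_pos (η.transportDist η') with h | h
  · rw [Config.transportDist_eq_zero] at h
    simp [h]
  · rw [mul_assoc, ENNReal.mul_inv_cancel (by simpa using h.ne') (by simp), mul_one,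
      Finsupp.tsub_apply]
    have : min (η i) (η' i) + (η i - η' i) = η i := by omega
    exact_mod_cast this

lemma pairing_ne_zero {η η' : Config F N} {i i' : F} (h : pairing η η' i i' ≠ 0) :
    η i ≠ 0 ∧ η' i' ≠ 0 ∧ (i = i' ∨ (η' i < η i ∧ η i' < η' i')) := by
  by_cases h1 : η' i < η i ∧ η i' < η' i'
  · exact ⟨by omega, by omega, Or.inr h1⟩
  have h2 : (((η.1 - η'.1) i : ℕ) : ℝ≥0∞) * (((η'.1 - η.1) i' : ℕ) : ℝ≥0∞) = 0 := by
    rw [← Nat.cast_mul, Nat.cast_eq_zero, mul_eq_zero, Finsupp.tsub_apply, Finsupp.tsub_apply]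
    omega
  rw [pairing, h2, ENNReal.zero_div, add_zero] at h
  split_ifs at h with hi
  · subst hi
    have : min (η i) (η' i) ≠ 0 := by exact_mod_cast h
    exact ⟨by omega, by omega, Or.inl rfl⟩
  · exact absurd rfl h

/-- The pairs of particles at the same site are the common particles. -/
lemma pairing_self (η η' : Config F N) (i : F) :
    pairing η η' i i = ((min (η i) (η' i) : ℕ) : ℝ≥0∞) := by
  have h2 : (((η.1 - η'.1) i : ℕ) : ℝ≥0∞) * (((η'.1 - η.1) i : ℕ) : ℝ≥0∞) = 0 := by
    rw [← Nat.cast_mul, Nat.cast_eq_zero, mul_eq_zero, Finsupp.tsub_apply, Finsupp.tsub_apply]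
    omega
  rw [pairing, h2, ENNReal.zero_div, add_zero, if_pos rfl]

lemma tsum_pairing_self_add (η η' : Config F N) :
    ∑' i, pairing η η' i i + η.transportDist η' = N := by
  rw [Config.transportDist, ← tsum_coe_eq_degree, ← ENNReal.tsum_add, ← η.tsum_coe]
  refine tsum_congr fun i => ?_
  rw [pairing_self, Finsupp.tsub_apply]
  have : min (η i) (η' i) + (η i - η' i) = η i := by omega
  exact_mod_cast this

lemma tsum_pairing_self (η η' : Config F N) :
    ∑' i, pairing η η' i i = ((N - η.transportDist η' : ℕ) : ℝ≥0∞) := by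
  have h := tsum_pairing_self_add η η'
  rw [ENNReal.eq_sub_of_add_eq (by simp) h, ENNReal.natCast_sub]

open Classical in
lemma tsum_pairing_offDiag (η η' : Config F N) :
    ∑' i, ∑' i', (if i = i' then 0 else pairing η η' i i') = η.transportDist η' := by
  have h1 : ∑' i, ∑' i', pairing η η' i i' = N := by simp_rw [tsum_pairing, η.tsum_coe]
  have h2 : ∀ i, ∑' i', pairing η η' i i' =
      pairing η η' i i + ∑' i', (if i = i' then 0 else pairing η η' i i') := fun i => by
    rw [ENNReal.tsum_eq_add_tsum_ite i]
    simp_rw [eq_comm]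
  simp_rw [h2, ENNReal.tsum_add, tsum_pairing_self] at h1
  have h3 := tsum_pairing_self_add η η'
  rw [tsum_pairing_self] at h3
  exact (ENNReal.add_right_inj (by simp)).1 (h1.trans h3.symm)

variable (a : F → F → ℝ≥0∞) (p : F → ℝ≥0)

/-- The part of the jump rate from `i` to `j` that a particle at `i` does not share with a paired
particle at `i'`. -/
def soloRate (η : Config F N) (i i' j : F) : ℝ≥0∞ :=
  (a i j - a i' j) + ((p i : ℝ≥0∞) - p i') * (η j / ((N - 1 : ℕ) : ℝ≥0∞))

open Classical in
/-- The rate at which a pair of particles at `(i, i')` jumps to `(j, j')`: both particles move to the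
same site at the largest possible rate, they die together at the largest possible rate and are
then reborn at a pair drawn from the pairing, and otherwise they move separately. -/
def pairRate (η η' : Config F N) (i i' j j' : F) : ℝ≥0∞ :=
  (if j = j' then min (a i j) (a i' j) else 0) +
    ((min (p i) (p i') : ℝ≥0) : ℝ≥0∞) * (pairing η η' j j' / ((N - 1 : ℕ) : ℝ≥0∞)) +
    (if j' = i' then soloRate a p η i i' j else 0) +
    (if j = i then soloRate a p η' i' i j' else 0)

open Classical in
lemma pairRate_comm (η η' : Config F N) (i i' j j' : F) :
    pairRate a p η η' i i' j j' = pairRate a p η' η i' i j' j := by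
  rw [pairRate, pairRate, pairing_comm, min_comm (p i), add_right_comm _ (ite _ _ _) (ite _ _ _)]
  congr 3
  by_cases h : j = j'
  · subst h; simp [min_comm]
  · rw [if_neg h, if_neg (Ne.symm h)]

/-- The first particle of a pair jumps at the rates of a single particle, up to jumps that do not
move it. -/
lemma tsum_pairRate_mul (η η' : Config F N) (i i' : F) (φ : F → ℝ≥0∞) :
    ∑' j, ∑' j', pairRate a p η η' i i' j j' * φ j =
      ∑' j, particleRate a p η i j * φ j + (∑' j', soloRate a p η' i' i j') * φ i := by
  classical
  have h1 : ∀ j, ∑' j', pairRate a p η η' i i' j j' = particleRate a p η i j +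
      if j = i then ∑' j', soloRate a p η' i' i j' else 0 := by
    intro j
    simp_rw [pairRate, ENNReal.tsum_add, ENNReal.tsum_mul_left, div_eq_mul_inv,
      ENNReal.tsum_mul_right, tsum_pairing]
    congr 1
    · rw [tsum_eq_single j fun j' hj' => if_neg hj'.symm, if_pos rfl,
        tsum_eq_single i' fun j' hj' => if_neg hj', if_pos rfl, soloRate, particleRate]
      have e1 : min (a i j) (a i' j) + (a i j - a i' j) = a i j := by
        rcases le_total (a i j) (a i' j) with h | h
        · rw [min_eq_left h, tsub_eq_zero_of_le h, add_zero]
        · rw [min_eq_right h, add_tsub_cancel_of_le h]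
      have e2 : ((min (p i) (p i') : ℝ≥0) : ℝ≥0∞) + ((p i : ℝ≥0∞) - p i') = p i := by
        rcases le_total (p i) (p i') with h | h
        · rw [min_eq_left h, tsub_eq_zero_of_le (by exact_mod_cast h), add_zero]
        · rw [min_eq_right h, add_tsub_cancel_of_le (by exact_mod_cast h)]
      conv_rhs => rw [← e1, ← e2]
      rw [div_eq_mul_inv]
      ring
    · split_ifs <;> simp
  simp_rw [ENNReal.tsum_mul_right, h1, add_mul, ENNReal.tsum_add]
  congr 1
  rw [tsum_eq_single i fun j hj => by rw [if_neg hj, zero_mul], if_pos rfl]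

variable {a}

lemma tsum_soloRate_le (η : Config F N) (i i' : F) :
    ∑' j, soloRate a p η i i' j ≤ ∑' j, particleRate a p η i j :=
  ENNReal.tsum_le_tsum fun _ => by
    rw [soloRate, particleRate]
    gcongr <;> exact tsub_le_self

lemma tsum_pairing_mul (η η' : Config F N) (f : F → ℝ≥0∞) :
    ∑' i, ∑' i', pairing η η' i i' * f i = ∑' i, η i * f i := by
  simp_rw [ENNReal.tsum_mul_right, tsum_pairing]

lemma tsum_pairing_mul' (η η' : Config F N) (f : F → ℝ≥0∞) :
    ∑' i, ∑' i', pairing η η' i i' * f i' = ∑' i, η' i * f i := by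
  rw [ENNReal.tsum_comm]
  simp_rw [pairing_comm η η', tsum_pairing_mul]

/-- The rate of the moves of a coupled pair that leave the first configuration unchanged. -/
def idleRate (a : F → F → ℝ≥0∞) (p : F → ℝ≥0) (η η' : Config F N) : ℝ≥0∞ :=
  ∑' i, ∑' i', pairing η η' i i' * ∑' j', soloRate a p η' i' i j'

lemma idleRate_ne_top (ha : ∀ i, ∑' j, a i j ≠ ∞) (hN : 2 ≤ N) (η η' : Config F N) :
    idleRate a p η η' ≠ ∞ := by
  refine ne_top_of_le_ne_top (tsum_config_mul_ne_top η'
    (tsum_particleRate_ne_top p ha hN η')) ?_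
  rw [← tsum_pairing_mul' η η']
  exact ENNReal.tsum_le_tsum fun i => ENNReal.tsum_le_tsum fun i' =>
    mul_le_mul_right (tsum_soloRate_le p η' i' i) _

/-- The sum over the moves of the coupled system of a function of the first configuration. -/
lemma tsum_coupled_fst (ha : ∀ i, ∑' j, a i j ≠ ∞) (hN : 2 ≤ N) (η η' : Config F N)
    (φ : Config F N → ℝ≥0∞) :
    ∑' i, ∑' i', pairing η η' i i' *
      ∑' j, ∑' j', pairRate a p η η' i i' j j' * φ (η.move i j) =
        (particleSystem p ha hN).jumpSum φ η + idleRate a p η η' * φ η := by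
  simp_rw [tsum_pairRate_mul a p η η' _ _ fun j => φ (η.move _ j), Config.move_self, mul_add,
    ENNReal.tsum_add, tsum_pairing_mul η η', ← mul_assoc, ENNReal.tsum_mul_right]
  rw [jumpSum_particleSystem, idleRate]

/-- The coupled system: two configurations whose paired particles jump together as much as
possible. The mark `((i, i'), (j, j'))` stands for a jump of a pair at `(i, i')` to `(j, j')`. -/
def coupledSystem (ha : ∀ i, ∑' j, a i j ≠ ∞) (hN : 2 ≤ N) :
    JumpSystem (Config F N × Config F N) ((F × F) × F × F) where
  rate x m := pairing x.1 x.2 m.1.1 m.1.2 * pairRate a p x.1 x.2 m.1.1 m.1.2 m.2.1 m.2.2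
  target x m := (x.1.move m.1.1 m.2.1, x.2.move m.1.2 m.2.2)
  total x := ((particleSystem p ha hN).total x.1 + idleRate a p x.1 x.2).toNNReal
  tsum_rate x := by
    rw [ENNReal.coe_toNNReal (ENNReal.add_ne_top.2 ⟨by simp, idleRate_ne_top p ha hN _ _⟩),
      ENNReal.tsum_prod (f := fun (m : F × F) (n : F × F) => pairing x.1 x.2 m.1 m.2 *
        pairRate a p x.1 x.2 m.1 m.2 n.1 n.2),
      ENNReal.tsum_prod (f := fun i i' => ∑' n : F × F, pairing x.1 x.2 i i' *
        pairRate a p x.1 x.2 i i' n.1 n.2)]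
    have h := tsum_coupled_fst p ha hN x.1 x.2 fun _ => 1
    rw [JumpSystem.jumpSum_const, mul_one, mul_one] at h
    rw [← h]
    refine tsum_congr fun i => tsum_congr fun i' => ?_
    rw [ENNReal.tsum_mul_left,
      ENNReal.tsum_prod (f := fun j j' => pairRate a p x.1 x.2 i i' j j')]
    simp

lemma jumpSum_coupledSystem (ha : ∀ i, ∑' j, a i j ≠ ∞) (hN : 2 ≤ N)
    (φ : Config F N × Config F N → ℝ≥0∞) (η η' : Config F N) :
    (coupledSystem p ha hN).jumpSum φ (η, η') =
      ∑' i, ∑' i', pairing η η' i i' * ∑' j, ∑' j', pairRate a p η η' i i' j j' *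
        φ (η.move i j, η'.move i' j') := by
  change ∑' m : (F × F) × F × F, (pairing η η' m.1.1 m.1.2 *
    pairRate a p η η' m.1.1 m.1.2 m.2.1 m.2.2) * φ (η.move m.1.1 m.2.1, η'.move m.1.2 m.2.2) = _
  rw [ENNReal.tsum_prod (f := fun (m : F × F) (n : F × F) => (pairing η η' m.1 m.2 *
        pairRate a p η η' m.1 m.2 n.1 n.2) * φ (η.move m.1 n.1, η'.move m.2 n.2)),
    ENNReal.tsum_prod (f := fun i i' => ∑' n : F × F, (pairing η η' i i' *
        pairRate a p η η' i i' n.1 n.2) * φ (η.move i n.1, η'.move i' n.2))]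
  refine tsum_congr fun i => tsum_congr fun i' => ?_
  simp_rw [mul_assoc]
  rw [ENNReal.tsum_mul_left, ENNReal.tsum_prod (f := fun j j' => pairRate a p η η' i i' j j' *
    φ (η.move i j, η'.move i' j'))]

lemma jumpSum_coupledSystem_fst (ha : ∀ i, ∑' j, a i j ≠ ∞) (hN : 2 ≤ N)
    (φ : Config F N → ℝ≥0∞) (x : Config F N × Config F N) :
    (coupledSystem p ha hN).jumpSum (fun z => φ z.1) x =
      (particleSystem p ha hN).jumpSum φ x.1 + idleRate a p x.1 x.2 * φ x.1 := by
  exact (jumpSum_coupledSystem p ha hN _ x.1 x.2).trans (tsum_coupled_fst p ha hN x.1 x.2 φ)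

lemma jumpSum_coupledSystem_snd (ha : ∀ i, ∑' j, a i j ≠ ∞) (hN : 2 ≤ N)
    (φ : Config F N → ℝ≥0∞) (x : Config F N × Config F N) :
    (coupledSystem p ha hN).jumpSum (fun z => φ z.2) x =
      (particleSystem p ha hN).jumpSum φ x.2 + idleRate a p x.2 x.1 * φ x.2 := by
  refine (jumpSum_coupledSystem p ha hN _ x.1 x.2).trans ?_
  rw [← tsum_coupled_fst, ENNReal.tsum_comm]
  refine tsum_congr fun i => tsum_congr fun i' => ?_
  rw [pairing_comm, ENNReal.tsum_comm]
  simp_rw [pairRate_comm a p x.1]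

end Coupling

/-! ### Contraction and conservativity of the coupling -/

section Contraction

variable {F : Type*} {N : ℕ} {a : F → F → ℝ≥0∞} {p : F → ℝ≥0}

/-- Two paired particles at different sites meet at rate at least `Λ` through their motion, and when
they die together they are reborn at a common particle. -/
lemma le_tsum_pairRate_self (haa : ∀ i, a i i = 0) {Λ β : ℝ≥0}
    (hΛ : ∀ i i', i ≠ i' → (Λ : ℝ≥0∞) ≤ a i i' + a i' i + ∑' j, min (a i j) (a i' j))
    (hβ : ∀ i, β ≤ p i) (η η' : Config F N) {i i' : F} (hii : i ≠ i') :
    (Λ : ℝ≥0∞) + β * (((N - η.transportDist η' : ℕ) : ℝ≥0∞) / ((N - 1 : ℕ) : ℝ≥0∞)) ≤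
      ∑' j, pairRate a p η η' i i' j j := by
  classical
  have h1 : a i i' = ∑' j, if j = i' then a i j else 0 := by
    rw [tsum_eq_single i' fun j hj => if_neg hj, if_pos rfl]
  have h2 : a i' i = ∑' j, if j = i then a i' j else 0 := by
    rw [tsum_eq_single i fun j hj => if_neg hj, if_pos rfl]
  have h3 : (β : ℝ≥0∞) * (((N - η.transportDist η' : ℕ) : ℝ≥0∞) / ((N - 1 : ℕ) : ℝ≥0∞)) =
      ∑' j, β * (pairing η η' j j / ((N - 1 : ℕ) : ℝ≥0∞)) := by
    simp_rw [ENNReal.tsum_mul_left, div_eq_mul_inv, ENNReal.tsum_mul_right, tsum_pairing_self]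
  calc _ ≤ a i i' + a i' i + ∑' j, min (a i j) (a i' j) +
        β * (((N - η.transportDist η' : ℕ) : ℝ≥0∞) / ((N - 1 : ℕ) : ℝ≥0∞)) := by
        gcongr
        exact hΛ i i' hii
    _ = ∑' j, (min (a i j) (a i' j) + β * (pairing η η' j j / ((N - 1 : ℕ) : ℝ≥0∞)) +
          (if j = i' then a i j else 0) + (if j = i then a i' j else 0)) := by
        rw [h3]
        nth_rewrite 1 [h1, h2]
        simp_rw [ENNReal.tsum_add]
        ring
    _ ≤ _ := by
        refine ENNReal.tsum_le_tsum fun j => ?_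
        rw [pairRate, if_pos rfl]
        have hm : β ≤ min (p i) (p i') := le_min (hβ i) (hβ i')
        gcongr
        · by_cases hj : j = i'
          · rw [if_pos hj, if_pos hj, soloRate, hj, haa, tsub_zero]
            exact le_self_add
          · rw [if_neg hj, if_neg hj]
        · by_cases hj : j = i
          · rw [if_pos hj, if_pos hj, soloRate, hj, haa, tsub_zero]
            exact le_self_add
          · rw [if_neg hj, if_neg hj]

open Classical in
/-- Two paired particles at the same site separate only when they die and are reborn at a pair of
excess particles. -/
lemma tsum_pairRate_offDiag_le {s : ℝ≥0} (hs : ∀ i, p i ≤ s) (η η' : Config F N) (i : F) :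
    ∑' j, ∑' j', pairRate a p η η' i i j j' * (if j = j' then 0 else 1) ≤
      s * (η.transportDist η' / ((N - 1 : ℕ) : ℝ≥0∞)) := by
  rw [← tsum_pairing_offDiag, div_eq_mul_inv, ← ENNReal.tsum_mul_right, ← ENNReal.tsum_mul_left]
  refine ENNReal.tsum_le_tsum fun j => ?_
  rw [← ENNReal.tsum_mul_right, ← ENNReal.tsum_mul_left]
  refine ENNReal.tsum_le_tsum fun j' => ?_
  by_cases h : j = j'
  · simp [h]
  · have hsolo : ∀ (ζ : Config F N) k, soloRate a p ζ i i k = 0 := fun ζ k => by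
      simp [soloRate]
    rw [pairRate, if_neg h, if_neg h, if_neg h, hsolo, hsolo, min_self, ite_self, ite_self,
      zero_add, add_zero, add_zero, mul_one, div_eq_mul_inv]
    gcongr
    exact hs i

open Classical in
/-- The expected variation of the transport distance when a given pair of particles jumps. -/
lemma tsum_pairRate_mul_transportDist_le (haa : ∀ i, a i i = 0) {Λ β s : ℝ≥0}
    (hΛ : ∀ i i', i ≠ i' → (Λ : ℝ≥0∞) ≤ a i i' + a i' i + ∑' j, min (a i j) (a i' j))
    (hβ : ∀ i, β ≤ p i) (hs : ∀ i, p i ≤ s) {η η' : Config F N} {i i' : F}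
    (hpair : pairing η η' i i' ≠ 0) :
    ∑' j, ∑' j', pairRate a p η η' i i' j j' * (η.move i j).transportDist (η'.move i' j') +
        (if i = i' then 0 else (Λ : ℝ≥0∞) +
          β * (((N - η.transportDist η' : ℕ) : ℝ≥0∞) / ((N - 1 : ℕ) : ℝ≥0∞))) ≤
      (∑' j, ∑' j', pairRate a p η η' i i' j j') * η.transportDist η' +
        (if i = i' then (s : ℝ≥0∞) * (η.transportDist η' / ((N - 1 : ℕ) : ℝ≥0∞)) else 0) := by
  obtain ⟨hi, hi', hor⟩ := pairing_ne_zero hpair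
  have hmove := Config.transportDist_move_le hi hi' hor
  by_cases hii : i = i'
  · subst hii
    rw [if_pos rfl, if_pos rfl, add_zero]
    refine le_trans ?_ (add_le_add_right (tsum_pairRate_offDiag_le (a := a) hs η η' i) _)
    simp_rw [← ENNReal.tsum_mul_right, ← ENNReal.tsum_add, ← mul_add]
    refine ENNReal.tsum_le_tsum fun j => ENNReal.tsum_le_tsum fun j' => mul_le_mul_right ?_ _
    have := hmove j j'
    rw [if_pos rfl, add_zero] at this
    exact_mod_cast this
  · rw [if_neg hii, if_neg hii, add_zero]
    refine (add_le_add_right (le_tsum_pairRate_self haa hΛ hβ η η' hii) _).trans ?_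
    have h1 : ∀ j, pairRate a p η η' i i' j j =
        ∑' j', pairRate a p η η' i i' j j' * (if j = j' then 1 else 0) := fun j => by
      rw [tsum_eq_single j fun j' hj' => by rw [if_neg hj'.symm, mul_zero], if_pos rfl, mul_one]
    simp_rw [h1, ← ENNReal.tsum_mul_right, ← ENNReal.tsum_add, ← mul_add]
    refine ENNReal.tsum_le_tsum fun j => ENNReal.tsum_le_tsum fun j' => mul_le_mul_right ?_ _
    have := hmove j j'
    rw [if_neg hii] at this
    have h2 : (η.move i j).transportDist (η'.move i' j') + (if j = j' then 1 else 0) ≤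
        η.transportDist η' := by
      split_ifs at this ⊢ <;> omega
    exact_mod_cast h2

/-- The transport distance is a Lyapunov function of the coupled system: it decreases at rate
at least `Λ + β - s`, where `β ≤ p ≤ s`. With `d` the distance, common pairs separate at rate at most
`s d / (N - 1)` each, excess pairs meet at rate at least `Λ + β (N - d) / (N - 1)` each, and
`(N - d) / (N - 1) ≤ 1` as soon as `d ≥ 1`. -/
lemma jumpSum_transportDist_le (ha : ∀ i, ∑' j, a i j ≠ ∞) (hN : 2 ≤ N) (haa : ∀ i, a i i = 0)
    {Λ β s : ℝ≥0}
    (hΛ : ∀ i i', i ≠ i' → (Λ : ℝ≥0∞) ≤ a i i' + a i' i + ∑' j, min (a i j) (a i' j))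
    (hβ : ∀ i, β ≤ p i) (hs : ∀ i, p i ≤ s) (x : Config F N × Config F N) :
    (coupledSystem p ha hN).jumpSum (fun z => z.1.transportDist z.2) x +
        ((Λ + β : ℝ≥0) : ℝ≥0∞) * x.1.transportDist x.2 ≤
      ((coupledSystem p ha hN).total x + s) * x.1.transportDist x.2 := by
  classical
  obtain ⟨η, η'⟩ := x
  dsimp only
  set d := η.transportDist η' with hd
  set n1 : ℝ≥0∞ := ((N - 1 : ℕ) : ℝ≥0∞) with hn1
  set γ : ℝ≥0∞ := ((N - d : ℕ) : ℝ≥0∞) / n1 with hγ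
  have hoff : ∀ K : ℝ≥0∞, ∑' i, ∑' i', pairing η η' i i' * (if i = i' then 0 else K) = d * K := by
    intro K
    rw [hd, ← tsum_pairing_offDiag]
    simp_rw [← ENNReal.tsum_mul_right]
    refine tsum_congr fun i => tsum_congr fun i' => ?_
    split_ifs <;> simp
  have hdiag : ∀ K : ℝ≥0∞, ∑' i, ∑' i', pairing η η' i i' * (if i = i' then K else 0) =
      ((N - d : ℕ) : ℝ≥0∞) * K := by
    intro K
    rw [hd, ← tsum_pairing_self, ← ENNReal.tsum_mul_right]
    refine tsum_congr fun i => ?_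
    rw [tsum_eq_single i fun i' hi' => by rw [if_neg hi'.symm, mul_zero], if_pos rfl]
  have htot : ((coupledSystem p ha hN).total (η, η') : ℝ≥0∞) =
      ∑' i, ∑' i', pairing η η' i i' * ∑' j, ∑' j', pairRate a p η η' i i' j j' := by
    have := jumpSum_coupledSystem p ha hN (fun _ => 1) η η'
    simpa using this
  have hmain : (coupledSystem p ha hN).jumpSum (fun z => z.1.transportDist z.2) (η, η') +
      d * ((Λ : ℝ≥0∞) + β * γ) ≤ (coupledSystem p ha hN).total (η, η') * d + s * γ * d := by
    have h1 : (s : ℝ≥0∞) * γ * d = ((N - d : ℕ) : ℝ≥0∞) * (s * (d / n1)) := by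
      simp only [hγ, div_eq_mul_inv]
      ring
    rw [h1, ← hoff, ← hdiag, htot, jumpSum_coupledSystem]
    simp_rw [← ENNReal.tsum_mul_right, ← ENNReal.tsum_add]
    refine ENNReal.tsum_le_tsum fun i => ENNReal.tsum_le_tsum fun i' => ?_
    rw [mul_assoc, ← mul_add, ← mul_add]
    rcases eq_or_ne (pairing η η' i i') 0 with h0 | h0
    · simp [h0]
    · exact mul_le_mul_right (tsum_pairRate_mul_transportDist_le haa hΛ hβ hs h0) _
  rcases Nat.eq_zero_or_pos d with h0 | h0
  · simpa [h0] using hmain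
  -- the complement of `γ` to one
  set γ' : ℝ≥0∞ := ((d - 1 : ℕ) : ℝ≥0∞) / n1 with hγ'
  have hsum : γ + γ' = 1 := by
    have hdN : d ≤ N := η.transportDist_le η'
    rw [hγ, hγ', ← ENNReal.add_div, ← Nat.cast_add, show N - d + (d - 1) = N - 1 by omega]
    exact ENNReal.div_self (Nat.cast_ne_zero.2 (by omega)) (by simp)
  have hp : β ≤ s := by
    obtain ⟨i, _⟩ : ∃ i, η i ≠ 0 := by
      by_contra! hcon
      have := η.tsum_coe
      simp only [hcon, Nat.cast_zero, tsum_zero] at this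
      have : N = 0 := by exact_mod_cast this.symm
      omega
    exact (hβ i).trans (hs i)
  calc _ = ((coupledSystem p ha hN).jumpSum (fun z => z.1.transportDist z.2) (η, η') +
        d * ((Λ : ℝ≥0∞) + β * γ)) + β * γ' * d := by
        have : (β : ℝ≥0∞) = β * (γ + γ') := by rw [hsum, mul_one]
        rw [ENNReal.coe_add]
        nth_rewrite 1 [this]
        ring
    _ ≤ ((coupledSystem p ha hN).total (η, η') * d + s * γ * d) + s * γ' * d := by
        gcongr
    _ = (coupledSystem p ha hN).total (η, η') * d + s * (γ + γ') * d := by ring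
    _ = _ := by rw [hsum]; ring

lemma coe_total_coupledSystem (ha : ∀ i, ∑' j, a i j ≠ ∞) (hN : 2 ≤ N)
    (x : Config F N × Config F N) :
    ((coupledSystem p ha hN).total x : ℝ≥0∞) =
      (particleSystem p ha hN).total x.1 + idleRate a p x.1 x.2 :=
  ENNReal.coe_toNNReal (ENNReal.add_ne_top.2 ⟨by simp, idleRate_ne_top p ha hN _ _⟩)

lemma coe_total_coupledSystem' (ha : ∀ i, ∑' j, a i j ≠ ∞) (hN : 2 ≤ N)
    (x : Config F N × Config F N) :
    ((coupledSystem p ha hN).total x : ℝ≥0∞) =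
      (particleSystem p ha hN).total x.2 + idleRate a p x.2 x.1 := by
  have := jumpSum_coupledSystem_snd p ha hN (fun _ => 1) x
  simpa using this

/-- The coupling does not explode, as the sum of a Lyapunov function over the particles of both
configurations is a Lyapunov function. -/
lemma isConservative_coupledSystem [Countable F] (ha : ∀ i, ∑' j, a i j ≠ ∞) (hN : 2 ≤ N)
    {V : F → ℝ≥0∞} (hV : ∀ i, V i ≠ ∞) (hVfin : ∀ r : ℝ≥0, {i | V i ≤ r}.Finite)
    (hLV : ∀ i, ∑' j, a i j * V j ≤ (∑' j, a i j + 1) * V i)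
    {s : ℝ≥0} (hs : ∀ i, p i ≤ s) : (coupledSystem p ha hN).IsConservative := by
  set b : ℝ≥0∞ := 1 + s * (N / ((N - 1 : ℕ) : ℝ≥0∞)) with hb
  have hbtop : b ≠ ∞ := ENNReal.add_ne_top.2 ⟨by simp,
    ENNReal.mul_ne_top (by simp) (natCast_div_ne_top hN N)⟩
  have hL := jumpSum_particleSum_le p ha hN hV hLV hs
  refine fun t ht x => (coupledSystem p ha hN).semigroup_one_eq
    (W := fun x => particleSum V x.1.1 + particleSum V x.2.1) (fun x => ?_) (fun r => ?_)
    b.toNNReal (fun x => ?_) ht x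
  · exact ENNReal.add_ne_top.2 ⟨tsum_config_mul_ne_top x.1 hV, tsum_config_mul_ne_top x.2 hV⟩
  · refine ((finite_particleSum_le hVfin r).prod (finite_particleSum_le hVfin r)).subset
      fun x (hx : particleSum V x.1.1 + particleSum V x.2.1 ≤ r) =>
        ⟨le_self_add.trans hx, le_add_self.trans hx⟩
  · rw [JumpSystem.jumpSum_add, ENNReal.coe_toNNReal hbtop, mul_add]
    refine add_le_add ?_ ?_
    · rw [jumpSum_coupledSystem_fst p ha hN (fun η => particleSum V η.1) x,
        coe_total_coupledSystem, add_right_comm, add_mul]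
      exact add_le_add_left (hL x.1) _
    · rw [jumpSum_coupledSystem_snd p ha hN (fun η => particleSum V η.1) x,
        coe_total_coupledSystem', add_right_comm, add_mul]
      exact add_le_add_left (hL x.2) _

end Contraction

/-! ### Evolution of laws -/

section Evolution

variable {S M : Type*} [Countable S] [Countable M] [MeasurableSpace S]
  [DiscreteMeasurableSpace S] (J : JumpSystem S M)

/-- The law at time `t` of the minimal process started from the law `μ`. -/
def JumpSystem.evolve (t : ℝ) (μ : Measure S) : Measure S :=
  Measure.sum fun y => (∫⁻ x, J.kernel t x y ∂μ) • Measure.dirac y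

lemma JumpSystem.lintegral_evolve (t : ℝ) (μ : Measure S) (f : S → ℝ≥0∞) :
    ∫⁻ y, f y ∂(J.evolve t μ) = ∫⁻ x, J.semigroup f t x ∂μ := by
  rw [evolve, lintegral_sum_measure]
  simp_rw [lintegral_smul_measure, lintegral_dirac, J.semigroup_eq_tsum f]
  rw [lintegral_tsum fun y => (Measurable.of_discrete).aemeasurable]
  refine tsum_congr fun y => ?_
  rw [lintegral_mul_const _ Measurable.of_discrete, smul_eq_mul]

lemma JumpSystem.evolve_apply (t : ℝ) (μ : Measure S) (B : Set S) :
    J.evolve t μ B = ∫⁻ x, J.semigroup (indicator B 1) t x ∂μ := by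
  rw [← J.lintegral_evolve, lintegral_indicator_one (MeasurableSet.of_discrete)]

lemma JumpSystem.evolve_singleton (t : ℝ) (μ : Measure S) (y : S) :
    J.evolve t μ {y} = ∫⁻ x, J.kernel t x y ∂μ := J.evolve_apply t μ {y}

lemma map_evolve {S' M' : Type*} [Countable S'] [Countable M'] [MeasurableSpace S']
    [DiscreteMeasurableSpace S'] {J' : JumpSystem S' M'} {J : JumpSystem S M} {π : S' → S} {t : ℝ}
    (h : ∀ g : S → ℝ≥0∞, (∀ x, g x ≤ 1) → ∀ x,
      J'.semigroup (fun z => g (π z)) t x = J.semigroup g t (π x)) (m : Measure S') :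
    (J'.evolve t m).map π = J.evolve t (m.map π) := by
  refine Measure.ext_of_singleton fun y => ?_
  rw [Measure.map_apply Measurable.of_discrete (measurableSet_singleton y), J'.evolve_apply,
    J.evolve_singleton, lintegral_map Measurable.of_discrete Measurable.of_discrete]
  refine lintegral_congr fun x => ?_
  exact h (indicator {y} 1) (fun z => indicator_le_self' (fun _ _ => zero_le_one) z) x

end Evolution

/-! ### Invariant distributions of contracting semigroups -/

section Invariant

variable {S M : Type*} [Countable S] [Countable M] {J : JumpSystem S M}

/-- The oscillation of the semigroup is controlled by the Markov property: `P_{t + s} g` is an average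
of `P_t g`. -/
lemma JumpSystem.IsConservative.semigroup_add_le (hJ : J.IsConservative) {ε : ℝ → ℝ≥0∞}
    (hosc : ∀ g : S → ℝ≥0∞, (∀ x, g x ≤ 1) → ∀ t, 0 ≤ t → ∀ x x',
      J.semigroup g t x ≤ J.semigroup g t x' + ε t)
    {g : S → ℝ≥0∞} (hg : ∀ x, g x ≤ 1) {t s : ℝ} (ht : 0 ≤ t) (hs : 0 ≤ s) (x x' : S) :
    J.semigroup g (t + s) x ≤ J.semigroup g t x' + ε t ∧
      J.semigroup g t x' ≤ J.semigroup g (t + s) x + ε t := by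
  have hconst : ∀ c : ℝ≥0∞, J.semigroup (fun _ => c) s x = c := fun c => by
    have := J.semigroup_const_mul c 1 s x
    simpa [hJ s hs x] using this
  rw [← hJ.semigroup_semigroup hg ht hs]
  constructor
  · refine (J.semigroup_mono (h := fun _ => J.semigroup g t x' + ε t)
      (fun y => hosc g hg t ht y x') s x).trans (hconst _).le
  · rw [← hconst (J.semigroup g t x'), ← hconst (ε t), ← J.semigroup_add]
    exact J.semigroup_mono (fun y => hosc g hg t ht x' y) s x

/-- If the oscillation of `P_t g` over the state space tends to zero, uniformly over the functions
`0 ≤ g ≤ 1`, then there is a unique invariant distribution. -/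
lemma JumpSystem.IsConservative.exists_invariant [Nonempty S] (hJ : J.IsConservative)
    {ε : ℝ → ℝ≥0∞} (hε : Tendsto (fun n : ℕ => ε n) atTop (𝓝 0))
    (hosc : ∀ g : S → ℝ≥0∞, (∀ x, g x ≤ 1) → ∀ t, 0 ≤ t → ∀ x x',
      J.semigroup g t x ≤ J.semigroup g t x' + ε t) :
    ∃ ν : S → ℝ≥0∞, ∑' y, ν y = 1 ∧ (∀ t, 0 ≤ t → ∀ y, ∑' x, ν x * J.kernel t x y = ν y) ∧
      ∀ ν' : S → ℝ≥0∞, ∑' y, ν' y = 1 →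
        (∀ t, 0 ≤ t → ∀ y, ∑' x, ν' x * J.kernel t x y = ν' y) → ν' = ν := by
  classical
  obtain ⟨x₀⟩ := ‹Nonempty S›
  have hind : ∀ (B : Set S) x, indicator B (1 : S → ℝ≥0∞) x ≤ 1 :=
    fun B x => indicator_le_self' (fun _ _ => zero_le_one) x
  -- from uniform closeness to convergence
  have hconv : ∀ {u : ℕ → ℝ≥0∞} {l : ℝ≥0∞}, l ≠ ∞ → (∀ n : ℕ, l ≤ u n + ε n) →
      (∀ n : ℕ, u n ≤ l + ε n) → Tendsto u atTop (𝓝 l) := by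
    intro u l hl h1 h2
    have e1 : Tendsto (fun n : ℕ => l - ε n) atTop (𝓝 l) := by
      have := ENNReal.Tendsto.sub (tendsto_const_nhds (x := l)) hε (Or.inl hl)
      simpa using this
    have e2 : Tendsto (fun n : ℕ => l + ε n) atTop (𝓝 l) := by
      simpa using hε.const_add l
    exact tendsto_of_tendsto_of_tendsto_of_le_of_le e1 e2
      (fun n => tsub_le_iff_right.2 (h1 n)) h2
  set u : S → ℕ → ℝ≥0∞ := fun y n => J.kernel n x₀ y with hu
  set ν : S → ℝ≥0∞ := fun y => limsup (u y) atTop with hν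
  have hu1 : ∀ y n, u y n ≤ 1 := fun y n =>
    (J.semigroup_mono (h := 1) (hind {y}) n x₀).trans (J.semigroup_one_le (by positivity) x₀)
  have hadd : ∀ B : Set S, ∀ n m : ℕ, n ≤ m →
      J.semigroup (indicator B 1) m x₀ ≤ J.semigroup (indicator B 1) n x₀ + ε n ∧
      J.semigroup (indicator B 1) n x₀ ≤ J.semigroup (indicator B 1) m x₀ + ε n := by
    intro B n m hnm
    have := hJ.semigroup_add_le hosc (hind B) (t := n) (s := (m : ℝ) - n) (by positivity)
      (by simpa using hnm) x₀ x₀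
    rwa [add_sub_cancel] at this
  have hlim : ∀ y, Tendsto (u y) atTop (𝓝 (ν y)) := by
    intro y
    have hν1 : ν y ≤ 1 := limsup_le_of_le (h := Eventually.of_forall (hu1 y))
    refine hconv (ne_top_of_le_ne_top ENNReal.one_ne_top hν1) (fun n => ?_) (fun n => ?_)
    · refine limsup_le_of_le (h := ?_)
      filter_upwards [eventually_ge_atTop n] with m hm
      exact (hadd {y} n m hm).1
    · rw [← tsub_le_iff_right]
      refine le_limsup_of_le (h := fun b hb => ?_)
      obtain ⟨m, hm, hnm⟩ := (hb.and (eventually_ge_atTop n)).exists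
      exact (tsub_le_iff_right.2 (hadd {y} n m hnm).2).trans hm
  have hfinset : ∀ (B : Finset S) n, ∑ y ∈ B, u y n = J.semigroup (indicator B 1) n x₀ := by
    intro B n
    rw [J.semigroup_eq_tsum, tsum_eq_sum (s := B) fun y hy => by simp [hy]]
    refine Finset.sum_congr rfl fun y hy => ?_
    simp [hy, hu]
  have hle1 : ∑' y, ν y ≤ 1 := by
    rw [ENNReal.tsum_eq_iSup_sum]
    refine iSup_le fun B => le_of_tendsto' (tendsto_finsetSum B fun y _ => hlim y) fun n => ?_
    rw [hfinset]
    exact (J.semigroup_mono (h := 1) (hind B) n x₀).trans (J.semigroup_one_le (by positivity) x₀)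
  have hge1 : 1 ≤ ∑' y, ν y := by
    have hm : ∀ m : ℕ, 1 ≤ ∑' y, ν y + ε m := by
      intro m
      have h1 : (1 : ℝ≥0∞) = ∑' y, u y m := by
        rw [← hJ m (by positivity) x₀, J.semigroup_eq_tsum]
        simp [hu]
      rw [h1, ENNReal.tsum_eq_iSup_sum]
      refine iSup_le fun B => ?_
      have h2 := (tendsto_finsetSum B fun y _ => hlim y).add_const (ε m)
      refine (ge_of_tendsto h2 ?_).trans (add_le_add_left (ENNReal.sum_le_tsum B) _)
      filter_upwards [eventually_ge_atTop m] with n hn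
      rw [hfinset, hfinset]
      exact (hadd B m n hn).2
    have h3 := hε.const_add (∑' y, ν y)
    rw [add_zero] at h3
    exact ge_of_tendsto' h3 hm
  have hsum := le_antisymm hle1 hge1
  refine ⟨ν, hsum, fun t ht => ?_, fun ν' h1 hinv => ?_⟩
  · have hle : ∀ y, ∑' x, ν x * J.kernel t x y ≤ ν y := by
      intro y
      rw [ENNReal.tsum_eq_iSup_sum]
      refine iSup_le fun B => ?_
      have h1 : Tendsto (fun n : ℕ => ∑ x ∈ B, u x n * J.kernel t x y) atTop
          (𝓝 (∑ x ∈ B, ν x * J.kernel t x y)) :=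
        tendsto_finsetSum B fun x _ => ENNReal.Tendsto.mul_const (hlim x)
          (Or.inr (ne_top_of_le_ne_top ENNReal.one_ne_top
            ((J.semigroup_mono (h := 1) (hind {y}) t x).trans (J.semigroup_one_le ht x))))
      have h2 : Tendsto (fun n : ℕ => u y n + ε n) atTop (𝓝 (ν y)) := by
        simpa using (hlim y).add hε
      refine le_of_tendsto_of_tendsto' h1 h2 fun n => ?_
      calc _ ≤ ∑' x, u x n * J.kernel t x y := ENNReal.sum_le_tsum B
        _ = J.semigroup (J.semigroup (indicator {y} 1) t) n x₀ := (J.semigroup_eq_tsum _ _ _).symm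
        _ = J.semigroup (indicator {y} 1) (n + t) x₀ := by
          rw [hJ.semigroup_semigroup (hind {y}) ht (by positivity), add_comm]
        _ ≤ _ := (hJ.semigroup_add_le hosc (hind {y}) (by positivity) ht x₀ x₀).1
    have hmass : ∑' y, ∑' x, ν x * J.kernel t x y = 1 := by
      rw [ENNReal.tsum_comm, ← hsum]
      refine tsum_congr fun x => ?_
      have := J.semigroup_eq_tsum 1 t x
      simp only [Pi.one_apply, mul_one] at this
      rw [ENNReal.tsum_mul_left, ← this, hJ t ht, mul_one]
    intro y
    by_contra hne
    have := ENNReal.tsum_lt_tsum (by rw [hmass]; simp) hle (lt_of_le_of_ne (hle y) hne)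
    rw [hmass, hsum] at this
    exact lt_irrefl _ this
  · ext y
    have hν'1 : ν' y ≤ 1 := h1 ▸ ENNReal.le_tsum y
    refine tendsto_nhds_unique (hconv (ne_top_of_le_ne_top ENNReal.one_ne_top hν'1)
      (fun n => ?_) fun n => ?_) (hlim y)
    · calc ν' y = ∑' x, ν' x * J.kernel n x y := (hinv n (by positivity) y).symm
        _ ≤ ∑' x, ν' x * (u y n + ε n) := ENNReal.tsum_le_tsum fun x =>
            mul_le_mul_right (hosc _ (hind {y}) n (by positivity) x x₀) _
        _ = _ := by rw [ENNReal.tsum_mul_right, h1, one_mul]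
    · calc u y n = ∑' x, ν' x * u y n := by rw [ENNReal.tsum_mul_right, h1, one_mul]
        _ ≤ ∑' x, ν' x * (J.kernel n x y + ε n) := ENNReal.tsum_le_tsum fun x =>
            mul_le_mul_right (hosc _ (hind {y}) n (by positivity) x₀ x) _
        _ = _ := by
          simp_rw [mul_add, ENNReal.tsum_add, ENNReal.tsum_mul_right]
          rw [hinv n (by positivity), h1, one_mul]

end Invariant

/-! ### The Fleming-Viot process -/

/-- The relation between the total rates in a projection of jump systems is its instance `φ = 1`. -/
lemma JumpSystem.exists_total_eq_add {S S' M M' : Type*} {J : JumpSystem S M}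
    {J' : JumpSystem S' M'} {π : S' → S} {x : S'} {s : ℝ≥0∞}
    (h : ∀ φ : S → ℝ≥0∞, J'.jumpSum (fun z => φ (π z)) x = J.jumpSum φ (π x) + s * φ (π x)) :
    ∃ s : ℝ≥0, J'.total x = J.total (π x) + s ∧ ∀ φ : S → ℝ≥0∞,
      J'.jumpSum (fun z => φ (π z)) x = J.jumpSum φ (π x) + s * φ (π x) := by
  have h1 := h fun _ => 1
  simp only [jumpSum_const, mul_one] at h1
  have hs : s ≠ ∞ := by
    rintro rfl
    simp at h1
  lift s to ℝ≥0 using hs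
  exact ⟨s, by exact_mod_cast h1, h⟩

section FlemingViotProcess

variable {F : Type*} {Q : F → F → ℝ} (hQ : IsRateMatrix Q) {p₀ : F → ℝ}
  (hp₀ : ∀ i, 0 ≤ p₀ i) {N : ℕ} (hN : 2 ≤ N)

/-- The minimal chain of the rate matrix of the Fleming-Viot process. -/
abbrev flemingViotChain : JumpSystem (Config F N) (Config F N) :=
  jumpSystemOfMatrix _ (hasExitRates_rateMatrix hQ hp₀ hN)

variable (p₀) in
/-- The coupling of two Fleming-Viot processes. -/
abbrev flemingViotCoupling :
    JumpSystem (Config F N × Config F N) ((F × F) × F × F) :=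
  coupledSystem (fun i => (p₀ i).toNNReal) (jumpRate_ne_top hQ) hN

lemma flemingViotCoupling_fst (x : Config F N × Config F N) :
    ∃ s : ℝ≥0, (flemingViotCoupling hQ p₀ hN).total x = (flemingViotChain hQ hp₀ hN).total x.1 + s ∧
      ∀ φ : Config F N → ℝ≥0∞, (flemingViotCoupling hQ p₀ hN).jumpSum (fun z => φ z.1) x =
        (flemingViotChain hQ hp₀ hN).jumpSum φ x.1 + s * φ x.1 :=
  JumpSystem.exists_total_eq_add (π := Prod.fst) fun φ => by
    rw [jumpSum_coupledSystem_fst, jumpSum_flemingViotSystem hQ hp₀ hN φ, add_assoc, ← add_mul]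

lemma flemingViotCoupling_snd (x : Config F N × Config F N) :
    ∃ s : ℝ≥0, (flemingViotCoupling hQ p₀ hN).total x = (flemingViotChain hQ hp₀ hN).total x.2 + s ∧
      ∀ φ : Config F N → ℝ≥0∞, (flemingViotCoupling hQ p₀ hN).jumpSum (fun z => φ z.2) x =
        (flemingViotChain hQ hp₀ hN).jumpSum φ x.2 + s * φ x.2 :=
  JumpSystem.exists_total_eq_add (π := Prod.snd) fun φ => by
    rw [jumpSum_coupledSystem_snd, jumpSum_flemingViotSystem hQ hp₀ hN φ, add_assoc, ← add_mul]

lemma isConservative_flemingViotCoupling [Countable F] (hrec : IsPositiveRecurrent Q)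
    (hbdd : BddAbove (range p₀)) : (flemingViotCoupling hQ p₀ hN).IsConservative := by
  obtain ⟨V, hV, hVfin, hLV⟩ := exists_lyapunov hQ.hasExitRates hrec
  refine isConservative_coupledSystem (jumpRate_ne_top hQ) hN hV hVfin (fun i => ?_)
    (s := (⨆ i, p₀ i).toNNReal) fun i => Real.toNNReal_le_toNNReal (le_ciSup hbdd i)
  rw [JumpSystem.tsum_rate]
  exact hLV i

lemma isConservative_flemingViotChain [Countable F] (hrec : IsPositiveRecurrent Q)
    (hbdd : BddAbove (range p₀)) : (flemingViotChain hQ hp₀ hN).IsConservative := by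
  intro t ht η
  refine le_antisymm (JumpSystem.semigroup_one_le _ ht η) ?_
  have h := JumpSystem.semigroup_comp_le (flemingViotChain hQ hp₀ hN)
    (flemingViotCoupling hQ p₀ hN) Prod.fst (flemingViotCoupling_fst hQ hp₀ hN) 1 ht (η, η)
  exact (isConservative_flemingViotCoupling hQ hN hrec hbdd t ht (η, η)).ge.trans h

lemma ergodicCoeff_term_nonneg (hQ : IsRateMatrix Q) [DecidableEq F] {i i' : F} (hii : i ≠ i') :
    (∀ j, 0 ≤ if j = i ∨ j = i' then 0 else min (Q i j) (Q i' j)) ∧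
      0 ≤ Q i i' + Q i' i + ∑' j, if j = i ∨ j = i' then 0 else min (Q i j) (Q i' j) := by
  have h : ∀ j, 0 ≤ if j = i ∨ j = i' then 0 else min (Q i j) (Q i' j) := fun j => by
    split_ifs with h
    · exact le_rfl
    · push Not at h
      exact le_min (hQ.nonneg _ _ h.1.symm) (hQ.nonneg _ _ h.2.symm)
  exact ⟨h, add_nonneg (add_nonneg (hQ.nonneg _ _ hii) (hQ.nonneg _ _ hii.symm)) (tsum_nonneg h)⟩

lemma ergodicCoeff_nonneg (hQ : IsRateMatrix Q) : 0 ≤ ergodicCoeff Q := by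
  classical
  exact Real.iInf_nonneg fun x => (ergodicCoeff_term_nonneg hQ x.2).2

/-- The coefficient `λ` bounds from below the rate at which two particles meet. -/
lemma ofReal_ergodicCoeff_le {i i' : F} (hii : i ≠ i') :
    ENNReal.ofReal (ergodicCoeff Q) ≤
      (jumpSystemOfMatrix Q hQ.hasExitRates).rate i i' +
      (jumpSystemOfMatrix Q hQ.hasExitRates).rate i' i +
      ∑' j, min ((jumpSystemOfMatrix Q hQ.hasExitRates).rate i j)
        ((jumpSystemOfMatrix Q hQ.hasExitRates).rate i' j) := by
  classical
  obtain ⟨h0, -⟩ := ergodicCoeff_term_nonneg hQ hii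
  have hsum : Summable fun j => if j = i ∨ j = i' then 0 else min (Q i j) (Q i' j) := by
    refine Summable.of_norm_bounded (hQ.row_sum i).summable.norm fun j => ?_
    rw [Real.norm_of_nonneg (h0 j)]
    split_ifs
    · exact norm_nonneg _
    · exact (min_le_left _ _).trans (le_abs_self _)
  have h1 := hQ.nonneg _ _ hii
  have h2 := hQ.nonneg _ _ hii.symm
  have hconv : ergodicCoeff Q ≤ Q i i' + Q i' i +
      ∑' j, if j = i ∨ j = i' then 0 else min (Q i j) (Q i' j) := by
    refine ciInf_le (ι := {x : F × F // x.1 ≠ x.2}) (f := fun x => Q x.1.1 x.1.2 + Q x.1.2 x.1.1 +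
      ∑' j, if j = x.1.1 ∨ j = x.1.2 then 0 else min (Q x.1.1 j) (Q x.1.2 j)) ⟨0, ?_⟩ ⟨(i, i'), hii⟩
    rintro _ ⟨x, rfl⟩
    exact (ergodicCoeff_term_nonneg hQ x.2).2
  refine (ENNReal.ofReal_le_ofReal hconv).trans (le_of_eq ?_)
  rw [ENNReal.ofReal_add (by positivity) (tsum_nonneg h0), ENNReal.ofReal_add h1 h2,
    ENNReal.ofReal_tsum_of_nonneg h0 hsum]
  simp only [jumpSystemOfMatrix, if_neg hii, if_neg hii.symm]
  congr 1
  refine tsum_congr fun j => ?_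
  by_cases hj : j = i
  · simp [hj]
  by_cases hj' : j = i'
  · simp [hj']
  · rw [if_neg (by tauto), if_neg hj, if_neg hj', (ENNReal.ofReal_mono).map_min]

/-- The expected distance of the coupled processes contracts at rate `ρ`. -/
lemma semigroup_transportDist_le [Nonempty F] (hQ : IsRateMatrix Q) (hp₀ : ∀ i, 0 ≤ p₀ i)
    (hN : 2 ≤ N) (hbdd : BddAbove (range p₀)) {t : ℝ} (ht : 0 ≤ t)
    (x : Config F N × Config F N) :
    (flemingViotCoupling hQ p₀ hN).semigroup (fun z => z.1.transportDist z.2) t x ≤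
      ENNReal.ofReal (Real.exp (-rho Q p₀ * t)) * x.1.transportDist x.2 := by
  have hbelow : BddBelow (range p₀) := ⟨0, by rintro _ ⟨i, rfl⟩; exact hp₀ i⟩
  have h := JumpSystem.semigroup_le_exp (flemingViotCoupling hQ p₀ hN)
    (f := fun z : Config F N × Config F N => (z.1.transportDist z.2 : ℝ≥0∞)) (by simp)
    ((ergodicCoeff Q).toNNReal + (⨅ i, p₀ i).toNNReal) (⨆ i, p₀ i).toNNReal
    (jumpSum_transportDist_le (jumpRate_ne_top hQ) hN
      (fun i => by simp [jumpSystemOfMatrix])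
      (fun i i' hii => ofReal_ergodicCoeff_le hQ hii)
      (fun i => Real.toNNReal_le_toNNReal (ciInf_le hbelow i))
      fun i => Real.toNNReal_le_toNNReal (le_ciSup hbdd i)) ht x
  refine h.trans (le_of_eq ?_)
  congr 4
  obtain ⟨i⟩ := ‹Nonempty F›
  rw [NNReal.coe_add, Real.coe_toNNReal _ (ergodicCoeff_nonneg hQ),
    Real.coe_toNNReal _ (Real.iInf_nonneg hp₀),
    Real.coe_toNNReal _ ((hp₀ i).trans (le_ciSup hbdd i)), rho]
  ring

/-- The law of a coupled pair at time `t` couples the laws at time `t`. -/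
lemma wasserstein_evolve_le [Countable F] [Nonempty F] (hrec : IsPositiveRecurrent Q)
    (hbdd : BddAbove (range p₀)) {t : ℝ} (ht : 0 ≤ t) (μ μ' : Measure (Config F N)) :
    wasserstein ((flemingViotChain hQ hp₀ hN).evolve t μ)
        ((flemingViotChain hQ hp₀ hN).evolve t μ') ≤
      ENNReal.ofReal (Real.exp (-rho Q p₀ * t)) * wasserstein μ μ' := by
  have hcons := isConservative_flemingViotCoupling hQ hN hrec hbdd
  have hc0 : ENNReal.ofReal (Real.exp (-rho Q p₀ * t)) ≠ 0 := by
    simp [Real.exp_pos]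
  have hctop : ENNReal.ofReal (Real.exp (-rho Q p₀ * t)) ≠ ∞ := ENNReal.ofReal_ne_top
  simp only [wasserstein, ENNReal.mul_iInf_of_ne hc0 hctop]
  refine le_iInf fun m => le_iInf fun h1 => le_iInf fun h2 => ?_
  refine iInf_le_of_le ((flemingViotCoupling hQ p₀ hN).evolve t m) ?_
  refine iInf_le_of_le ?_ (iInf_le_of_le ?_ ?_)
  · rw [← h1]
    exact map_evolve (fun g hg x => hcons.semigroup_comp Prod.fst
      (flemingViotCoupling_fst hQ hp₀ hN) hg ht x) m
  · rw [← h2]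
    exact map_evolve (fun g hg x => hcons.semigroup_comp Prod.snd
      (flemingViotCoupling_snd hQ hp₀ hN) hg ht x) m
  · simp_rw [ofReal_d₁]
    rw [JumpSystem.lintegral_evolve, ← lintegral_const_mul _ Measurable.of_discrete]
    exact lintegral_mono fun x => semigroup_transportDist_le hQ hp₀ hN hbdd ht x

/-- Two processes started anywhere are at distance at most `N`, hence differ with probability at most
`exp (-ρ t) N` at time `t`. -/
lemma semigroup_le_add [Countable F] [Nonempty F] (hrec : IsPositiveRecurrent Q)
    (hbdd : BddAbove (range p₀)) {g : Config F N → ℝ≥0∞} (hg : ∀ x, g x ≤ 1) {t : ℝ}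
    (ht : 0 ≤ t) (η η' : Config F N) :
    (flemingViotChain hQ hp₀ hN).semigroup g t η ≤
      (flemingViotChain hQ hp₀ hN).semigroup g t η' +
        ENNReal.ofReal (Real.exp (-rho Q p₀ * t)) * N := by
  have hcons := isConservative_flemingViotCoupling hQ hN hrec hbdd
  rw [← hcons.semigroup_comp Prod.fst (flemingViotCoupling_fst hQ hp₀ hN) hg ht (η, η'),
    ← hcons.semigroup_comp Prod.snd (flemingViotCoupling_snd hQ hp₀ hN) hg ht (η, η')]
  calc _ ≤ (flemingViotCoupling hQ p₀ hN).semigroup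
        (fun z => g z.2 + z.1.transportDist z.2) t (η, η') := by
        refine JumpSystem.semigroup_mono _ (fun z => ?_) t _
        rcases Nat.eq_zero_or_pos (z.1.transportDist z.2) with h | h
        · rw [Config.transportDist_eq_zero.1 h]
          exact le_self_add
        · exact (hg _).trans (le_add_left (by exact_mod_cast h))
    _ ≤ _ := by
        rw [JumpSystem.semigroup_add]
        gcongr
        refine (semigroup_transportDist_le hQ hp₀ hN hbdd ht _).trans ?_
        gcongr
        exact Config.transportDist_le _ _

/-- The one-dimensional marginals of a Fleming-Viot process. -/
lemma IsMarkovJumpProcess.map_eq_evolve [Countable F] {Ω : Type*} [MeasurableSpace Ω]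
    {P : Measure Ω} {X : ℝ≥0 → Ω → Config F N} (hX : IsMarkovJumpProcess (rateMatrix Q p₀ N) P X)
    (t : ℝ≥0) : P.map (X t) = (flemingViotChain hQ hp₀ hN).evolve t (P.map (X 0)) := by
  refine Measure.ext_of_singleton fun y => ?_
  have h := hX.markov 0 t univ MeasurableSet.univ y
  rw [univ_inter, zero_add, Measure.restrict_univ] at h
  rw [Measure.map_apply (hX.measurable t) (measurableSet_singleton y), h,
    JumpSystem.evolve_singleton, lintegral_map Measurable.of_discrete (hX.measurable 0)]
  simp_rw [transProb_eq_kernel _ (hasExitRates_rateMatrix hQ hp₀ hN)]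

lemma IsInvariantDistribution.evolve_eq [Countable F] {ν : Measure (Config F N)}
    (hν : IsInvariantDistribution (rateMatrix Q p₀ N) ν) (t : ℝ≥0) :
    (flemingViotChain hQ hp₀ hN).evolve t ν = ν := by
  refine Measure.ext_of_singleton fun y => ?_
  rw [JumpSystem.evolve_singleton, ← hν.invariant t y]
  simp_rw [transProb_eq_kernel _ (hasExitRates_rateMatrix hQ hp₀ hN)]

lemma exists_unique_isInvariantDistribution [Countable F] [Nonempty F]
    (hQ : IsRateMatrix Q) (hp₀ : ∀ i, 0 ≤ p₀ i) (hN : 2 ≤ N)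
    (hrec : IsPositiveRecurrent Q) (hbdd : BddAbove (range p₀)) (hρ : 0 < rho Q p₀) :
    ∃ ν : Measure (Config F N), IsInvariantDistribution (rateMatrix Q p₀ N) ν ∧
      ∀ ν', IsInvariantDistribution (rateMatrix Q p₀ N) ν' → ν' = ν := by
  have : Nonempty (Config F N) := by
    obtain ⟨i⟩ := ‹Nonempty F›
    exact ⟨⟨Finsupp.single i N, Finsupp.degree_single i N⟩⟩
  have hlim : Tendsto (fun n : ℕ => ENNReal.ofReal (Real.exp (-rho Q p₀ * (n : ℝ))) * N) atTop
      (𝓝 0) := by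
    have h1 : Tendsto (fun n : ℕ => Real.exp (-rho Q p₀ * (n : ℝ))) atTop (𝓝 0) := by
      refine Real.tendsto_exp_atBot.comp ?_
      exact tendsto_natCast_atTop_atTop.const_mul_atTop_of_neg (by linarith)
    have h2 := ENNReal.tendsto_ofReal h1
    rw [ENNReal.ofReal_zero] at h2
    simpa using ENNReal.Tendsto.mul_const (b := (N : ℝ≥0∞)) h2 (Or.inr (by simp))
  obtain ⟨ν, hν1, hinv, huniq⟩ :=
    (isConservative_flemingViotChain hQ hp₀ hN hrec hbdd).exists_invariant
      (ε := fun t => ENNReal.ofReal (Real.exp (-rho Q p₀ * t)) * N) hlim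
      fun g hg t ht x x' => semigroup_le_add hQ hp₀ hN hrec hbdd hg ht x x'
  have hs : ∀ y, (Measure.sum fun y => ν y • Measure.dirac y) {y} = ν y := fun y => by
    rw [Measure.sum_apply _ (measurableSet_singleton y),
      tsum_eq_single y fun z hz => by simp [hz]]
    simp
  refine ⟨Measure.sum fun y => ν y • Measure.dirac y, ⟨⟨?_⟩, fun t y => ?_⟩, fun ν' h' => ?_⟩
  · rw [Measure.sum_apply _ MeasurableSet.univ]
    simpa using hν1
  · rw [lintegral_countable', hs, ← hinv t t.coe_nonneg y]
    refine tsum_congr fun x => ?_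
    rw [hs, mul_comm, transProb_eq_kernel _ (hasExitRates_rateMatrix hQ hp₀ hN)]
  · refine Measure.ext_of_singleton fun y => ?_
    rw [hs]
    refine congrFun (huniq (fun y => ν' {y}) ?_ fun t ht y => ?_) y
    · have := lintegral_countable' (μ := ν') fun _ => 1
      have hp := h'.isProbabilityMeasure
      simpa using this.symm
    · have := h'.invariant ⟨t, ht⟩ y
      rw [← this, lintegral_countable']
      refine tsum_congr fun x => ?_
      rw [mul_comm, transProb_eq_kernel _ (hasExitRates_rateMatrix hQ hp₀ hN)]
      rfl

end FlemingViotProcess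

end FlemingViot

end

open FlemingViot in
theorem mainTheorem1 {F : Type*} [Countable F] [Nontrivial F]
    (Q : F → F → ℝ) (hQ : IsRateMatrix Q) (hirr : IsIrreducible Q) (hrec : IsPositiveRecurrent Q)
    (p₀ : F → ℝ) (hp₀ : ∀ i, 0 ≤ p₀ i) (hp₀_ne : p₀ ≠ 0) (hp₀_bdd : BddAbove (Set.range p₀))
    (N : ℕ) (hN : 2 ≤ N) :
    (∀ {Ω : Type*} [MeasurableSpace Ω] (P : Measure Ω) [IsProbabilityMeasure P]
        {Ω' : Type*} [MeasurableSpace Ω'] (P' : Measure Ω') [IsProbabilityMeasure P']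
        (η : ℝ≥0 → Ω → Config F N) (η' : ℝ≥0 → Ω' → Config F N),
        IsMarkovJumpProcess (rateMatrix Q p₀ N) P η →
        IsMarkovJumpProcess (rateMatrix Q p₀ N) P' η' →
        ∀ t : ℝ≥0,
          wasserstein (P.map (η t)) (P'.map (η' t)) ≤
            ENNReal.ofReal (Real.exp (-rho Q p₀ * t)) *
              wasserstein (P.map (η 0)) (P'.map (η' 0))) ∧
    (0 < rho Q p₀ →
      ∃ ν : Measure (Config F N),
        IsInvariantDistribution (rateMatrix Q p₀ N) ν ∧
        (∀ ν', IsInvariantDistribution (rateMatrix Q p₀ N) ν' → ν' = ν) ∧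
        ∀ {Ω : Type*} [MeasurableSpace Ω] (P : Measure Ω) [IsProbabilityMeasure P]
          (η : ℝ≥0 → Ω → Config F N), IsMarkovJumpProcess (rateMatrix Q p₀ N) P η →
          ∀ t : ℝ≥0,
            wasserstein (P.map (η t)) ν ≤
              ENNReal.ofReal (Real.exp (-rho Q p₀ * t)) *
                wasserstein (P.map (η 0)) ν) := by
  refine ⟨fun P _ _ _ P' _ η η' hη hη' t => ?_, fun hρ => ?_⟩
  · rw [hη.map_eq_evolve hQ hp₀ hN t, hη'.map_eq_evolve hQ hp₀ hN t]
    exact wasserstein_evolve_le hQ hp₀ hN hrec hp₀_bdd t.coe_nonneg _ _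
  · obtain ⟨ν, hν, huniq⟩ :=
      exists_unique_isInvariantDistribution hQ hp₀ hN hrec hp₀_bdd hρ
    refine ⟨ν, hν, huniq, fun P _ η hη t => ?_⟩
    have h := wasserstein_evolve_le hQ hp₀ hN hrec hp₀_bdd t.coe_nonneg (P.map (η 0)) ν
    rwa [← hη.map_eq_evolve hQ hp₀ hN t, hν.evolve_eq hQ hp₀ hN t] at h
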